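/- Let $n\ge 1$ and let $\phi:\mathbb{R}^n\to\mathbb{C}$ be a smooth function which is symmetric (invariant under all permutations of the variables), satisfies $\phi(x_1+t,\dots,x_n+t)=\phi(x_1,\dots,x_n)$ for all $t\in\mathbb{R}$, and is a Schwartz function on the hyperplane $\sum x_j=0$ (that is, $\phi$ and all its partial derivatives decay there faster than any polynomial). Suppose that there is a Schwartz function $\Phi\in\mathcal{S}(\mathbb{R}^n)$, supported in $\{\sum_{j}|\xi_j|<2\}$, such that $$\phi(x_1,\dots,x_n)=\int_{\mathbb{R}^n}\Phi(\xi_1,\dots,\xi_n)\,\delta(\xi_1+\dots+\xi_n)\,e^{2\pi i\sum_{j=1}^n\xi_jx_j}\,d\xi_1\cdots d\xi_n,$$ where $\delta$ is the Dirac delta, i.e. the right-hand side is the integral over $(\xi_1,\dots,\xi_{n-1})\in\mathbb{R}^{n-1}$ with $\xi_n=-(\xi_1+\dots+\xi_{n-1})$. For $N\ge1$ put $$\tilde\phi(x_1,\dots,x_n)=\sum_{u_1,\dots,u_{n-1}\in\mathbb{Z}}\phi\big(N(x_1+u_1),\dots,N(x_{n-1}+u_{n-1}),Nx_n\big),$$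 and for a unitary $N\times N$ matrix $U$ with eigenvalues $e^{2\pi i\theta_1},\dots,e^{2\pi i\theta_N}$ (with multiplicity) let $$C_n(U,\phi)=\frac1N\sum_{1\le j_1,\dots,j_n\le N}\tilde\phi(\theta_{j_1},\dots,\theta_{j_n}),$$ which does not depend on the choice of the real numbers $\theta_j$. Then $U\mapsto C_n(U,\phi)$ is integrable with respect to the normalised Haar measure $dU$ on $\mathrm{U}(N)$, and $$\int_{\mathrm{U}(N)}C_n(U,\phi)\,dU=\Phi(0)+\sum_{m=1}^{\lfloor n/2\rfloor}\ \sum_{\{(\alpha_1,\beta_1),\dots,(\alpha_m,\beta_m)\}}\int_{\mathbb{R}^m}\Phi\Big(\sum_{j=1}^m\xi_j e_{\alpha_j,\beta_j}\Big)\prod_{j=1}^m|\xi_j|\,d\xi_j+O(1/N)$$ as $N\to\infty$, where the inner sum is over all sets of $m$ pairwise disjoint pairs $(\alpha_j,\beta_j)$ with $1\le\alpha_j<\beta_j\le n$, $e_{i,k}=e_i-e_k$ with $e_1,\dots,e_n$ the standard basis of $\mathbb{R}^n$, and the implied constant depends only on $n$ and $\phi$. -/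

import Mathlib

open MeasureTheory

open scoped ContDiff

noncomputable section

namespace UnitaryCorrelation

/-! ### The unitary group and its normalised Haar measure -/

instance instMeasurableSpaceUnitaryGroup (N : ℕ) :
    MeasurableSpace (Matrix.unitaryGroup (Fin N) ℂ) := borel _

instance instBorelSpaceUnitaryGroup (N : ℕ) :
    BorelSpace (Matrix.unitaryGroup (Fin N) ℂ) := ⟨rfl⟩

instance instCompactSpaceUnitaryGroup (N : ℕ) :
    CompactSpace (Matrix.unitaryGroup (Fin N) ℂ) := by
  have hK : IsCompact (Set.univ.pi fun _ => Set.univ.pi fun _ => Metric.closedBall (0 : ℂ) 1 :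
      Set (Fin N → Fin N → ℂ)) :=
    isCompact_univ_pi fun _ => isCompact_univ_pi fun _ => isCompact_closedBall _ _
  have hclosed : IsClosed {A : Matrix (Fin N) (Fin N) ℂ | star A * A = 1} :=
    isClosed_eq (by fun_prop) continuous_const
  refine isCompact_iff_compactSpace.mp (?_ : IsCompact
    (Matrix.unitaryGroup (Fin N) ℂ : Set (Matrix (Fin N) (Fin N) ℂ)))
  refine IsCompact.of_isClosed_subset (s := (Set.univ.pi fun _ => Set.univ.pi fun _ =>
    Metric.closedBall (0 : ℂ) 1 : Set (Fin N → Fin N → ℂ))) hK ?_ ?_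
  · have heq : (Matrix.unitaryGroup (Fin N) ℂ : Set (Matrix (Fin N) (Fin N) ℂ)) =
        {A | star A * A = 1} := by
      ext A
      exact Matrix.mem_unitaryGroup_iff'
    rw [heq]
    exact hclosed
  · intro A hA i _ j _
    simpa using entry_norm_bound_of_unitary hA i j

/-- The normalised (total mass one) Haar measure on `U(N)`. -/
def haarUnitary (N : ℕ) : Measure (Matrix.unitaryGroup (Fin N) ℂ) :=
  Measure.haarMeasure ⊤

/-! ### Test functions

Functions of `n = d + 1 ≥ 1` real variables, indexed by `Fin (d + 1)`. -/

/-- Smooth, symmetric, translation invariant functions which are Schwartz on the hyperplane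
`∑ x_j = 0`. -/
structure IsTestFunction {d : ℕ} (φ : (Fin (d + 1) → ℝ) → ℂ) : Prop where
  smooth : ContDiff ℝ ∞ φ
  symmetric : ∀ (σ : Equiv.Perm (Fin (d + 1))) (x : Fin (d + 1) → ℝ), φ (fun j => x (σ j)) = φ x
  translation : ∀ (x : Fin (d + 1) → ℝ) (t : ℝ), φ (fun j => x j + t) = φ x
  decay : ∀ k m : ℕ, ∃ C : ℝ, ∀ x : Fin (d + 1) → ℝ, ∑ j, x j = 0 →
    ‖x‖ ^ k * ‖iteratedFDeriv ℝ m φ x‖ ≤ C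

/-- `∫ f(ξ) δ(ξ_1 + ⋯ + ξ_n) dξ_1 ⋯ dξ_n`, with the Dirac delta integrated out in the last
variable. -/
def deltaIntegral {d : ℕ} (f : (Fin (d + 1) → ℝ) → ℂ) : ℂ :=
  ∫ η : Fin d → ℝ, f (Fin.snoc (α := fun _ => ℝ) η (-∑ j, η j))

/-- `φ(x) = ∫ Φ(ξ) δ(ξ_1 + ⋯ + ξ_n) e^{2πi ∑ ξ_j x_j} dξ` where `Φ` vanishes outside
`∑ |ξ_j| < 2`. -/
structure IsRestrictedTransform {d : ℕ} (φ : (Fin (d + 1) → ℝ) → ℂ)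
    (Φ : SchwartzMap (Fin (d + 1) → ℝ) ℂ) : Prop where
  support : ∀ ξ : Fin (d + 1) → ℝ, Φ ξ ≠ 0 → ∑ j, |ξ j| < 2
  eq_integral : ∀ x : Fin (d + 1) → ℝ, φ x =
    deltaIntegral fun ξ => Φ ξ * Complex.exp (2 * Real.pi * Complex.I * (∑ j, ξ j * x j : ℝ))

/-- The periodic test function
`∑_{u_1, …, u_{n-1} ∈ ℤ} φ(N(x_1 + u_1), …, N(x_{n-1} + u_{n-1}), N x_n)`. -/
def periodized {d : ℕ} (N : ℕ) (φ : (Fin (d + 1) → ℝ) → ℂ) (x : Fin (d + 1) → ℝ) : ℂ :=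
  ∑' u : Fin d → ℤ, φ (Fin.snoc (α := fun _ => ℝ)
    (fun j => N * (x j.castSucc + u j)) (N * x (Fin.last d)))

/-! ### Eigenangles and correlations -/

/-- `e^{2πi θ_1}, …, e^{2πi θ_N}` are the eigenvalues of `U`, with algebraic multiplicity. -/
def IsEigenangles {N : ℕ} (U : Matrix (Fin N) (Fin N) ℂ) (θ : Fin N → ℝ) : Prop :=
  U.charpoly.roots =
    Finset.univ.val.map fun j => Complex.exp (2 * Real.pi * Complex.I * (θ j : ℂ))

theorem norm_eq_one_of_mem_roots {N : ℕ} (U : Matrix.unitaryGroup (Fin N) ℂ) {z : ℂ}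
    (hz : z ∈ (U : Matrix (Fin N) (Fin N) ℂ).charpoly.roots) : ‖z‖ = 1 := by
  have hroot := Polynomial.isRoot_of_mem_roots hz
  rw [← Matrix.mem_spectrum_iff_isRoot_charpoly] at hroot
  open scoped Matrix.Norms.L2Operator in
  have := spectrum.subset_circle_of_unitary U.2 hroot
  simpa using this

theorem exists_isEigenangles {N : ℕ} (U : Matrix.unitaryGroup (Fin N) ℂ) :
    ∃ θ : Fin N → ℝ, IsEigenangles (U : Matrix (Fin N) (Fin N) ℂ) θ := by
  set s := (U : Matrix (Fin N) (Fin N) ℂ).charpoly.roots with hs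
  have hcard : s.card = N := by
    rw [hs, ← (IsAlgClosed.splits _).natDegree_eq_card_roots, Matrix.charpoly_natDegree_eq_dim,
      Fintype.card_fin]
  have hl : s.toList.length = N := by simpa using hcard
  refine ⟨fun j => Complex.arg (s.toList.get (j.cast hl.symm)) / (2 * Real.pi), ?_⟩
  have hexp : ∀ j : Fin N, Complex.exp (2 * Real.pi * Complex.I *
      ((Complex.arg (s.toList.get (j.cast hl.symm)) / (2 * Real.pi) : ℝ) : ℂ))
      = s.toList.get (j.cast hl.symm) := by
    intro j
    set z := s.toList.get (j.cast hl.symm) with hz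
    have hmem : z ∈ s := by
      rw [← Multiset.mem_toList]
      exact List.get_mem _ _
    have h1 : ‖z‖ = 1 := norm_eq_one_of_mem_roots U hmem
    have h2 := Complex.norm_mul_exp_arg_mul_I z
    rw [h1, Complex.ofReal_one, one_mul] at h2
    have hpi : (Real.pi : ℂ) ≠ 0 := by exact_mod_cast Real.pi_ne_zero
    conv_rhs => rw [← h2]
    congr 1
    push_cast
    field_simp
  unfold IsEigenangles
  simp only [hexp]
  rw [← hs]
  have : (List.ofFn fun j : Fin N => s.toList.get (j.cast hl.symm)) = s.toList := by
    apply List.ext_get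
    · simp [hl]
    · intro i h1 h2
      simp
  conv_lhs => rw [← Multiset.coe_toList s, ← this]
  rw [List.ofFn_eq_map]
  rfl

/-- A choice of eigenangles of a unitary matrix. -/
def eigenangles {N : ℕ} (U : Matrix.unitaryGroup (Fin N) ℂ) : Fin N → ℝ :=
  (exists_isEigenangles U).choose

/-- `(1/N) ∑_{1 ≤ j_1, …, j_n ≤ N} φ̃(θ_{j_1}, …, θ_{j_n})`. -/
def angleCorrelation {d N : ℕ} (φ : (Fin (d + 1) → ℝ) → ℂ) (θ : Fin N → ℝ) : ℂ :=
  (1 / N : ℂ) * ∑ j : Fin (d + 1) → Fin N, periodized N φ fun i => θ (j i)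

/-- The unrestricted `n`-correlation `C_n(U, φ)`. -/
def correlation {d N : ℕ} (U : Matrix.unitaryGroup (Fin N) ℂ)
    (φ : (Fin (d + 1) → ℝ) → ℂ) : ℂ :=
  angleCorrelation φ (eigenangles U)

theorem periodized_add_int {d : ℕ} (N : ℕ) {φ : (Fin (d + 1) → ℝ) → ℂ} (hφ : IsTestFunction φ)
    (x : Fin (d + 1) → ℝ) (k : Fin (d + 1) → ℤ) :
    periodized N φ (fun i => x i + k i) = periodized N φ x := by
  unfold periodized
  rw [← (Equiv.addRight (fun j : Fin d => k (Fin.last d) - k j.castSucc)).tsum_eq]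
  refine tsum_congr fun u => ?_
  rw [← hφ.translation (Fin.snoc (α := fun _ => ℝ) (fun j => N * (x j.castSucc + u j))
    (N * x (Fin.last d))) (N * k (Fin.last d))]
  congr 1
  ext i
  refine Fin.lastCases ?_ (fun j => ?_) i
  · simp
    ring
  · simp
    ring

theorem exists_perm_of_map_eq {N : ℕ} (f g : Fin N → ℂ)
    (h : Finset.univ.val.map f = Finset.univ.val.map g) :
    ∃ σ : Equiv.Perm (Fin N), ∀ j, f j = g (σ j) := by
  classical
  have hc : ∀ c : ℂ, Nonempty ({a // f a = c} ≃ {b // g b = c}) := by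
    intro c
    refine ⟨Fintype.equivOfCardEq ?_⟩
    have h2 := congrArg (Multiset.count c) h
    rw [Multiset.count_map, Multiset.count_map] at h2
    rw [Fintype.card_subtype, Fintype.card_subtype]
    simpa [Finset.card, eq_comm] using h2
  refine ⟨Equiv.ofFiberEquiv fun c => (hc c).some, fun j => ?_⟩
  exact (Equiv.ofFiberEquiv_map _ j).symm

/-- The `n`-correlation does not depend on the choice of eigenangles. -/
theorem correlation_eq_angleCorrelation {d N : ℕ} (U : Matrix.unitaryGroup (Fin N) ℂ)
    {φ : (Fin (d + 1) → ℝ) → ℂ} (hφ : IsTestFunction φ) {θ : Fin N → ℝ}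
    (hθ : IsEigenangles (U : Matrix (Fin N) (Fin N) ℂ) θ) :
    correlation U φ = angleCorrelation φ θ := by
  have h0 : IsEigenangles (U : Matrix (Fin N) (Fin N) ℂ) (eigenangles U) :=
    (exists_isEigenangles U).choose_spec
  unfold correlation
  generalize eigenangles U = θ₀ at h0
  unfold IsEigenangles at h0 hθ
  rw [h0] at hθ
  obtain ⟨σ, hσ⟩ := exists_perm_of_map_eq _ _ hθ
  have hk : ∀ j, ∃ k : ℤ, θ₀ j = θ (σ j) + k := by
    intro j
    have h := hσ j
    obtain ⟨k, hk⟩ := Complex.exp_eq_exp_iff_exists_int.mp h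
    refine ⟨k, ?_⟩
    have h2 : (2 * Real.pi * Complex.I : ℂ) ≠ 0 := Complex.two_pi_I_ne_zero
    have h3 : (θ₀ j : ℂ) = θ (σ j) + k := by
      apply mul_left_cancel₀ h2
      rw [hk]
      ring
    exact_mod_cast h3
  choose k hk using hk
  unfold angleCorrelation
  congr 1
  conv_rhs => rw [← (Equiv.arrowCongr (Equiv.refl (Fin (d + 1))) σ).sum_comp]
  refine Finset.sum_congr rfl fun j _ => ?_
  simp only [hk]
  exact periodized_add_int N hφ _ fun i => k (j i)

/-! ### The main term -/

open Classical in
/-- Sets `{(α_1, β_1), …, (α_m, β_m)}` of `m` pairwise disjoint pairs of indices with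
`α_j < β_j`. -/
def disjointPairs (n m : ℕ) : Finset (Finset (Fin n × Fin n)) :=
  Finset.univ.filter fun σ => σ.card = m ∧ (∀ p ∈ σ, p.1 < p.2) ∧
    ∀ p ∈ σ, ∀ q ∈ σ, p ≠ q → p.1 ≠ q.1 ∧ p.1 ≠ q.2 ∧ p.2 ≠ q.1 ∧ p.2 ≠ q.2

/-- The vector `e_{i,k} = e_i - e_k`. -/
def basisDiff {n : ℕ} (i k : Fin n) : Fin n → ℝ :=
  Pi.single i 1 - Pi.single k 1

/-- `Φ(0) + ∑_{1 ≤ m ≤ n/2} ∑_{σ} ∫_{ℝ^m} Φ(∑ ξ_j e_{α_j,β_j}) ∏ |ξ_j| dξ_j`, the coordinates of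
`ℝ^m` being indexed by the `m` elements of the set of pairs `σ`. -/
def mainTerm {n : ℕ} (Φ : SchwartzMap (Fin n → ℝ) ℂ) : ℂ :=
  Φ 0 + ∑ m ∈ Finset.Icc 1 (n / 2), ∑ σ ∈ disjointPairs n m,
    ∫ ξ : σ → ℝ, Φ (∑ p : σ, ξ p • basisDiff p.1.1 p.1.2) * ((∏ p : σ, |ξ p| : ℝ) : ℂ)

end UnitaryCorrelation

end

/-! Poisson summation turns the periodized test function into a finite trigonometric polynomial
(`periodized_eq_sum`). Summed over eigenangles it gives C_n(U, φ) = N^{-n} ∑_k Φ(k/N) ∏ tr U^{k_i},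
over integer vectors k with zero sum (`correlation_eq_sum`). The support of Φ forces ∑|k_i| < 2N, so
the positive and negative parts of k each have mass below N. In that range the Haar moments of
traces of powers are exactly Gaussian: the mean of ∏ tr U^{k_i} is N^{#zeros} times the sum, over
ways to pair each positive entry with an opposite negative one, of ∏|k| over the pairs
(`integral_prod_tracePow`). Exchanging the sums, each set σ of m pairs leaves one free integer per
pair and yields a Riemann sum of mesh 1/N for its integral in the main term
(`integral_correlation`). The integrand is Lipschitz on unit scale with compact support, so the
error is O(1/N); the empty σ gives Φ(0) exactly.

The moment formula (`integral_prod_trace_pow`) is proved without characters or Weingarten functions.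
A product of traces of powers is a tensor power of U contracted along a permutation. By invariance,
a matrix of entry moments intertwines tensor powers of unitaries, hence for at most N tensor factors
is a combination of permutations (`apply_eq_sum_equiv_of_commute_unitary`). Its coefficients are
unknown, but the sums that occur collapse by the orthonormality of the rows of U
(`sum_entryMoment_comp`), leaving a count of bijections conjugating one permutation to the other
(`integral_trace_perm`, `card_intertwiners`). -/

noncomputable section

namespace UnitaryCorrelation

/-! ### Traces of powers -/

section TracePow

variable {ι R : Type*} [Fintype ι] [DecidableEq ι] [CommSemiring R]

/-- Expansion over walks from a to b: f lists the m interior vertices, `Fin.cons` gives the sources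
of the steps and `Fin.snoc` their targets. -/
theorem matrix_pow_succ_apply (M : Matrix ι ι R) (m : ℕ) (a b : ι) :
    (M ^ (m + 1)) a b = ∑ f : Fin m → ι, ∏ i : Fin (m + 1),
      M (Fin.cons (α := fun _ => ι) a f i) (Fin.snoc (α := fun _ => ι) f b i) := by
  induction m generalizing a with
  | zero => simp [Fin.snoc]
  | succ m ih =>
    rw [pow_succ', Matrix.mul_apply, ← (Fin.consEquiv fun _ => ι).sum_comp, Fintype.sum_prod_type]
    refine Finset.sum_congr rfl fun c _ => ?_
    rw [ih, Finset.mul_sum]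
    refine Finset.sum_congr rfl fun f _ => ?_
    rw [Fin.prod_univ_succ (n := m + 1)]
    simp [Fin.consEquiv, ← Fin.cons_snoc_eq_snoc_cons]

theorem trace_pow_eq_sum_cycle (M : Matrix ι ι R) (m : ℕ) [NeZero m] :
    (M ^ m).trace = ∑ f : ZMod m → ι, ∏ x, M (f x) (f (x + 1)) := by
  obtain ⟨c, rfl⟩ := Nat.exists_eq_succ_of_ne_zero (NeZero.ne m)
  -- `ZMod (c + 1)` unfolds to `Fin (c + 1)`, where adding 1 wraps around and closes the walk.
  change _ = ∑ f : Fin (c + 1) → ι, ∏ x : Fin (c + 1), M (f x) (f (x + 1))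
  rw [← (Fin.consEquiv fun _ => ι).sum_comp, Fintype.sum_prod_type, Matrix.trace]
  refine Finset.sum_congr rfl fun a _ => ?_
  rw [Matrix.diag_apply, matrix_pow_succ_apply]
  refine Finset.sum_congr rfl fun f _ => Finset.prod_congr rfl fun i _ => ?_
  have hi : Fin.snoc (α := fun _ => ι) f a i = Fin.cons (α := fun _ => ι) a f (i + 1) := by
    rw [Fin.snoc_eq_cons_rotate]
    beta_reduce
    rw [finRotate_apply]
  rw [hi]
  rfl

/-- A labelling of a disjoint union of cycles is an independent labelling of each cycle. A product
of traces of powers thus becomes one contraction of a tensor power along a permutation, the form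
averaged in `integral_trace_perm`. -/
theorem sum_prod_sigma_cycle {P : Type*} [Fintype P] [DecidableEq P] (m : P → ℕ) [∀ p, NeZero (m p)]
    (M : Matrix ι ι R) :
    ∑ f : (Σ p, ZMod (m p)) → ι, ∏ x, M (f x) (f ⟨x.1, x.2 + 1⟩) = ∏ p, (M ^ m p).trace := by
  simp only [trace_pow_eq_sum_cycle]
  rw [Finset.prod_univ_sum, Fintype.piFinset_univ, ← (Equiv.piCurry fun _ _ => ι).sum_comp]
  refine Finset.sum_congr rfl fun f _ => ?_
  rw [Fintype.prod_sigma]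
  rfl

end TracePow

/-! ### Tensor powers and their commutant -/

section TensorPower

variable {J ι R : Type*} [Fintype J] [CommRing R]

/-- The matrix of the tensor power of `M` in the standard basis. -/
def tensorPower (J : Type*) [Fintype J] (M : Matrix ι ι R) : Matrix (J → ι) (J → ι) R :=
  Matrix.of fun f g => ∏ i, M (f i) (g i)

theorem tensorPower_apply (M : Matrix ι ι R) (f g : J → ι) :
    tensorPower J M f g = ∏ i, M (f i) (g i) := rfl

theorem tensorPower_conjTranspose [StarRing R] (M : Matrix ι ι R) :
    tensorPower J M.conjTranspose = (tensorPower J M).conjTranspose := by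
  ext f g
  simp [tensorPower_apply, Matrix.conjTranspose_apply]

theorem tensorPower_diagonal [DecidableEq ι] (w : ι → R) :
    tensorPower J (Matrix.diagonal w) = Matrix.diagonal fun f => ∏ i, w (f i) := by
  ext f g
  rw [tensorPower_apply, Matrix.diagonal_apply]
  split_ifs with h
  · simp [h]
  · obtain ⟨i, hi⟩ := Function.ne_iff.mp h
    exact Finset.prod_eq_zero (Finset.mem_univ i) (Matrix.diagonal_apply_ne _ hi)

theorem tensorPower_one [DecidableEq ι] : tensorPower J (1 : Matrix ι ι R) = 1 := by
  rw [← Matrix.diagonal_one, tensorPower_diagonal]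
  simp

variable [DecidableEq J] [Fintype ι]

theorem tensorPower_mul (M M' : Matrix ι ι R) :
    tensorPower J (M * M') = tensorPower J M * tensorPower J M' := by
  ext f g
  simp only [tensorPower_apply, Matrix.mul_apply, ← Finset.prod_mul_distrib]
  rw [Finset.prod_univ_sum, Fintype.piFinset_univ]

end TensorPower

theorem exists_equiv_of_map_eq {J J' κ : Type*} [Fintype J] [Fintype J']
    (f : J → κ) (g : J' → κ) (h : Finset.univ.val.map f = Finset.univ.val.map g) :
    ∃ σ : J ≃ J', ∀ j, f j = g (σ j) := by
  classical
  have hc : ∀ c, Nonempty ({a // f a = c} ≃ {b // g b = c}) := by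
    intro c
    refine ⟨Fintype.equivOfCardEq ?_⟩
    have h2 := congrArg (Multiset.count c) h
    rw [Multiset.count_map, Multiset.count_map] at h2
    rw [Fintype.card_subtype, Fintype.card_subtype]
    simpa [Finset.card, eq_comm] using h2
  exact ⟨Equiv.ofFiberEquiv fun c => (hc c).some, fun j => (Equiv.ofFiberEquiv_map _ j).symm⟩

theorem prod_update_one_comp {K ι R : Type*} [Fintype K] [DecidableEq ι] [CommMonoid R] (c : ι)
    (ζ : R) (f : K → ι) :
    ∏ i, Function.update (1 : ι → R) c ζ (f i) =
      ζ ^ Multiset.count c (Finset.univ.val.map f) := by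
  simp only [Function.update_apply, Pi.one_apply, Finset.prod_ite, Finset.prod_const, one_pow,
    mul_one]
  congr 1
  rw [Multiset.count_map]
  simp only [eq_comm (a := c)]
  rfl

theorem tensorPower_selfMap_apply {K ι R : Type*} [Fintype K] [DecidableEq K] [DecidableEq ι]
    [CommRing R] (h : ι → ι) (f g : K → ι) :
    tensorPower K (Matrix.of fun r c => if h c = r then 1 else 0 : Matrix ι ι R) f g =
      if f = h ∘ g then 1 else 0 := by
  simp only [tensorPower_apply, Matrix.of_apply]
  rw [Fintype.prod_boole]
  refine if_congr ?_ rfl rfl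
  simp only [funext_iff, Function.comp_apply]
  exact forall_congr' fun _ => eq_comm

/-! ### Matrices intertwining tensor powers of unitary matrices -/

section Commutant

variable {J J' ι : Type*} [Fintype J] [Fintype J'] [Fintype ι] [DecidableEq ι] [DecidableEq J]
  [DecidableEq J'] {A : Matrix (J → ι) (J' → ι) ℂ}

/-- Test against the diagonal unitary with ζ at c and 1 elsewhere: a nonzero entry forces ζ^a = ζ^b,
where a and b are the multiplicities of c in f and g. The order of the root of unity ζ is taken
larger than both. -/
theorem map_eq_map_of_commute_unitary
    (hA : ∀ V ∈ Matrix.unitaryGroup ι ℂ, tensorPower J V * A = A * tensorPower J' V)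
    {f : J → ι} {g : J' → ι} (hfg : A f g ≠ 0) :
    Finset.univ.val.map f = Finset.univ.val.map g := by
  ext c
  set M := Fintype.card J + Fintype.card J' + 1 with hM
  have hM0 : M ≠ 0 := by omega
  set ζ := Complex.exp (2 * Real.pi * Complex.I / M) with hζ
  have hprim : IsPrimitiveRoot ζ M := Complex.isPrimitiveRoot_exp M hM0
  have hnorm : ‖ζ‖ = 1 := hprim.norm'_eq_one hM0
  set w : ι → ℂ := Function.update 1 c ζ with hw
  have hV : Matrix.diagonal w ∈ Matrix.unitaryGroup ι ℂ := by
    rw [Matrix.mem_unitaryGroup_iff, Matrix.star_eq_conjTranspose, Matrix.diagonal_conjTranspose,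
      Matrix.diagonal_mul_diagonal, ← Matrix.diagonal_one]
    congr 1
    ext i
    by_cases hi : i = c
    · subst hi
      simp [hw, Complex.mul_conj, Complex.normSq_eq_norm_sq, hnorm]
    · simp [hw, hi]
  have key := congrFun (congrFun (hA _ hV) f) g
  rw [tensorPower_diagonal, tensorPower_diagonal, Matrix.diagonal_mul, Matrix.mul_diagonal,
    mul_comm] at key
  have := mul_left_cancel₀ hfg key
  rw [hw, prod_update_one_comp, prod_update_one_comp] at this
  refine hprim.pow_inj ?_ ?_ this
  · refine lt_of_le_of_lt (Multiset.count_le_card _ _) ?_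
    simp [hM]
  · refine lt_of_le_of_lt (Multiset.count_le_card _ _) ?_
    simp [hM]

/-- At a nonzero entry f and g have the same values with multiplicity, so the two scalars agree for
every w, even one with zero entries. -/
theorem commute_diagonal_of_commute_unitary
    (hA : ∀ V ∈ Matrix.unitaryGroup ι ℂ, tensorPower J V * A = A * tensorPower J' V) (w : ι → ℂ) :
    tensorPower J (Matrix.diagonal w) * A = A * tensorPower J' (Matrix.diagonal w) := by
  ext f g
  rw [tensorPower_diagonal, tensorPower_diagonal, Matrix.diagonal_mul, Matrix.mul_diagonal,
    mul_comm]
  by_cases hfg : A f g = 0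
  · simp [hfg]
  · have h := congrArg (fun s : Multiset ι => (s.map w).prod) (map_eq_map_of_commute_unitary hA hfg)
    simp only [Multiset.map_map] at h
    exact congrArg _ h

/-- The matrix of a self-map of the index set is a diagonal matrix times a unitary one. -/
theorem exists_diagonal_mul_unitary (h : ι → ι) :
    ∃ w : ι → ℂ, ∃ V ∈ Matrix.unitaryGroup ι ℂ,
      (Matrix.of fun r c => if h c = r then 1 else 0 : Matrix ι ι ℂ) = Matrix.diagonal w * V := by
  classical
  -- Row r is the indicator of the fibre of h over r and w r is its length. Distinct rows have
  -- disjoint supports, so the nonzero rows, normalised, are orthonormal.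
  set w : ι → ℝ := fun r => Real.sqrt (Finset.univ.filter fun c => h c = r).card with hw
  have hpos : ∀ r ∈ Set.range h, 0 < w r := by
    rintro _ ⟨c, rfl⟩
    refine Real.sqrt_pos.mpr (Nat.cast_pos.mpr (Finset.card_pos.mpr ⟨c, by simp⟩))
  set v : ι → EuclideanSpace ℂ ι := fun r => WithLp.toLp 2 fun c =>
    if h c = r then ((w r)⁻¹ : ℂ) else 0 with hv
  have hon : Orthonormal ℂ ((Set.range h).domRestrict v) := by
    rw [orthonormal_iff_ite]
    rintro ⟨r, hr⟩ ⟨s, hs⟩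
    simp only [Set.domRestrict_apply, hv, PiLp.inner_apply, Subtype.mk.injEq]
    split_ifs with hrs
    · subst hrs
      have : ∀ c, inner ℂ (if h c = r then ((w r)⁻¹ : ℂ) else 0)
          (if h c = r then ((w r)⁻¹ : ℂ) else 0) = if h c = r then (((w r) ^ 2)⁻¹ : ℂ) else 0 := by
        intro c
        split_ifs
        · rw [RCLike.inner_apply, map_inv₀, Complex.conj_ofReal, sq, mul_inv]
        · simp
      simp only [this]
      rw [Finset.sum_ite, Finset.sum_const_zero, add_zero, Finset.sum_const, nsmul_eq_mul]
      have h2 : ((w r) ^ 2 : ℂ) = ((Finset.univ.filter fun c => h c = r).card : ℂ) := by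
        rw [hw, ← Complex.ofReal_pow, Real.sq_sqrt (by positivity)]
        simp
      rw [← h2]
      have := (hpos r hr).ne'
      have : (w r : ℂ) ≠ 0 := by exact_mod_cast this
      field_simp
    · refine Finset.sum_eq_zero fun c _ => ?_
      split_ifs with h1 h2
      · exact absurd (h1.symm.trans h2) hrs
      all_goals simp
  -- The rows outside the range of h are filled in arbitrarily; there w vanishes and the diagonal
  -- factor kills them.
  obtain ⟨b, hb⟩ := hon.exists_orthonormalBasis_extension_of_card_eq (by simp)
  refine ⟨fun r => w r, Matrix.of fun r c => b r c, ?_, ?_⟩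
  · rw [Matrix.mem_unitaryGroup_iff]
    ext r s
    have h1 := orthonormal_iff_ite.mp b.orthonormal s r
    simp only [PiLp.inner_apply, RCLike.inner_apply] at h1
    simp only [Matrix.mul_apply, Matrix.star_apply, Matrix.of_apply, Matrix.one_apply]
    simp only [eq_comm (a := r)]
    exact h1
  · ext r c
    rw [Matrix.diagonal_mul, Matrix.of_apply, Matrix.of_apply]
    by_cases hr : r ∈ Set.range h
    · rw [hb r hr]
      have := (hpos r hr).ne'
      have : (w r : ℂ) ≠ 0 := by exact_mod_cast this
      simp only [hv]
      split_ifs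
      · field_simp
      · simp
    · have h0 : w r = 0 := by
        rw [hw]
        simp only [Real.sqrt_eq_zero', Nat.cast_nonpos, Finset.card_eq_zero]
        refine Finset.filter_eq_empty_iff.mpr fun c _ hc => hr ⟨c, hc⟩
      rw [if_neg fun hc => hr ⟨c, hc⟩, h0]
      simp

/-- In the stable range, the commutant of the tensor powers of unitary matrices is spanned by
permutations of the tensor factors. -/
theorem apply_eq_sum_equiv_of_commute_unitary
    (hA : ∀ V ∈ Matrix.unitaryGroup ι ℂ, tensorPower J V * A = A * tensorPower J' V)
    {e : J' → ι} (he : Function.Injective e) (f : J → ι) (g : J' → ι) :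
    A f g = ∑ σ : J ≃ J', if f = g ∘ σ then A (e ∘ σ) e else 0 := by
  -- Injectivity of e makes every g of the form h ∘ e. The matrix X of h is diagonal times unitary,
  -- so A intertwines its tensor powers too, and this expresses column g of A through column e. The
  -- value of h off the range of e is immaterial.
  set h : ι → ι := Function.extend e g id with hh
  have hg : g = h ∘ e := by
    ext j
    simp [hh, he.extend_apply]
  obtain ⟨w, V, hV, hX⟩ := exists_diagonal_mul_unitary h
  set X : Matrix ι ι ℂ := Matrix.of fun r c => if h c = r then 1 else 0 with hXdef
  have hcomm : tensorPower J X * A = A * tensorPower J' X := by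
    rw [hX, tensorPower_mul, tensorPower_mul, Matrix.mul_assoc, hA V hV, ← Matrix.mul_assoc,
      commute_diagonal_of_commute_unitary hA, Matrix.mul_assoc]
  have key := congrFun (congrFun hcomm f) e
  have h2 : (A * tensorPower J' X) f e = A f g := by
    rw [Matrix.mul_apply, Finset.sum_eq_single g]
    · rw [tensorPower_selfMap_apply, if_pos hg, mul_one]
    · intro g' _ hg'
      rw [tensorPower_selfMap_apply, if_neg (hg ▸ hg'), mul_zero]
    · simp
  have h1 : (tensorPower J X * A) f e = ∑ f', if f = h ∘ f' then A f' e else 0 := by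
    rw [Matrix.mul_apply]
    refine Finset.sum_congr rfl fun f' _ => ?_
    rw [tensorPower_selfMap_apply]
    split_ifs <;> simp
  rw [← h2, ← key, h1]
  symm
  -- Column e is supported on rearrangements e ∘ σ, and these are distinct because e is injective.
  refine Fintype.sum_of_injective (fun σ : J ≃ J' => e ∘ σ) ?_ _ _ ?_ ?_
  · intro σ τ hστ
    ext x
    exact he (congrFun hστ x)
  · intro f' hf'
    split_ifs
    · by_contra hne
      obtain ⟨σ, hσ⟩ := exists_equiv_of_map_eq _ _ (map_eq_map_of_commute_unitary hA hne)
      exact hf' ⟨σ, (funext hσ).symm⟩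
    · rfl
  · intro σ
    simp only [hg, Function.comp_assoc]

end Commutant

/-! ### Moments of matrix entries under Haar measure -/

instance instIsFiniteMeasureHaarUnitary (N : ℕ) : IsFiniteMeasure (haarUnitary N) := by
  unfold haarUnitary
  infer_instance

instance instIsMulLeftInvariantHaarUnitary (N : ℕ) : (haarUnitary N).IsMulLeftInvariant := by
  unfold haarUnitary
  infer_instance

theorem haarUnitary_univ (N : ℕ) : haarUnitary N Set.univ = 1 := by
  have := Measure.haarMeasure_self (K₀ := (⊤ : TopologicalSpace.PositiveCompacts
    (Matrix.unitaryGroup (Fin N) ℂ)))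
  simpa [haarUnitary] using this

instance instIsProbabilityMeasureHaarUnitary (N : ℕ) : IsProbabilityMeasure (haarUnitary N) :=
  ⟨haarUnitary_univ N⟩

theorem integrable_haarUnitary {N : ℕ} {F : Matrix.unitaryGroup (Fin N) ℂ → ℂ}
    (hF : Continuous F) : Integrable F (haarUnitary N) :=
  hF.integrable_of_hasCompactSupport (HasCompactSupport.of_compactSpace F)

section Moments

variable {N : ℕ} {J J' : Type*} [Fintype J] [Fintype J']

@[fun_prop]
theorem continuous_unitaryGroup_apply (a b : Fin N) :
    Continuous fun U : Matrix.unitaryGroup (Fin N) ℂ => (U : Matrix (Fin N) (Fin N) ℂ) a b :=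
  (continuous_apply_apply a b).comp continuous_subtype_val

/-- The Haar average of `∏ U_{f i, a i} ∏ conj U_{g j, b j}`. -/
def entryMoment (N : ℕ) (a : J → Fin N) (b : J' → Fin N) :
    Matrix (J → Fin N) (J' → Fin N) ℂ :=
  Matrix.of fun f g => ∫ U : Matrix.unitaryGroup (Fin N) ℂ,
    (∏ i, (U : Matrix (Fin N) (Fin N) ℂ) (f i) (a i)) *
      ∏ j, star ((U : Matrix (Fin N) (Fin N) ℂ) (g j) (b j)) ∂(haarUnitary N)

/-- Matching the columns through τ and summing over them turns each factor into an inner product of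
two rows of U, so the integrand is constant. This makes the coefficients of the commutant expansion
summable without computing them. -/
theorem sum_entryMoment_comp [DecidableEq J'] (τ : J ≃ J') (f : J → Fin N) (g : J' → Fin N) :
    ∑ h : J' → Fin N, entryMoment N (h ∘ τ) h f g = if f = g ∘ τ then 1 else 0 := by
  simp only [entryMoment, Matrix.of_apply]
  rw [← integral_finsetSum _ fun h _ => integrable_haarUnitary (by fun_prop)]
  have : ∀ U : Matrix.unitaryGroup (Fin N) ℂ, ∑ h : J' → Fin N,
      (∏ i, (U : Matrix (Fin N) (Fin N) ℂ) (f i) ((h ∘ τ) i)) *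
        ∏ j, star ((U : Matrix (Fin N) (Fin N) ℂ) (g j) (h j)) =
      if f = g ∘ τ then 1 else 0 := by
    intro U
    have h1 : ∀ h : J' → Fin N, (∏ i, (U : Matrix (Fin N) (Fin N) ℂ) (f i) ((h ∘ τ) i)) *
        ∏ j, star ((U : Matrix (Fin N) (Fin N) ℂ) (g j) (h j)) =
        ∏ j, (U : Matrix (Fin N) (Fin N) ℂ) (f (τ.symm j)) (h j) *
          star ((U : Matrix (Fin N) (Fin N) ℂ) (g j) (h j)) := by
      intro h
      rw [Finset.prod_mul_distrib, ← τ.symm.prod_comp]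
      simp
    have h2 : ∀ j, ∑ c, (U : Matrix (Fin N) (Fin N) ℂ) (f (τ.symm j)) c *
        star ((U : Matrix (Fin N) (Fin N) ℂ) (g j) c) = if f (τ.symm j) = g j then 1 else 0 := by
      intro j
      have := congrFun (congrFun (Matrix.mem_unitaryGroup_iff.mp U.2) (f (τ.symm j))) (g j)
      rw [Matrix.mul_apply, Matrix.one_apply] at this
      exact this
    simp only [h1]
    have h3 := Finset.prod_univ_sum (fun _ : J' => (Finset.univ : Finset (Fin N)))
      fun j c => (U : Matrix (Fin N) (Fin N) ℂ) (f (τ.symm j)) c *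
        star ((U : Matrix (Fin N) (Fin N) ℂ) (g j) c)
    rw [Fintype.piFinset_univ] at h3
    rw [← h3]
    simp only [h2]
    rw [Fintype.prod_boole]
    refine if_congr ⟨fun h => ?_, fun h j => ?_⟩ rfl rfl
    · ext i
      simpa using congrArg Fin.val (h (τ i))
    · simp [h]
  simp only [this]
  simp

variable [DecidableEq J] [DecidableEq J']

/-- Left invariance of Haar measure: the substitution of VU for U acts on the row indices only. -/
theorem tensorPower_mul_entryMoment_mul (a : J → Fin N) (b : J' → Fin N)
    (V : Matrix.unitaryGroup (Fin N) ℂ) :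
    tensorPower J (V : Matrix (Fin N) (Fin N) ℂ) * entryMoment N a b *
      (tensorPower J' (V : Matrix (Fin N) (Fin N) ℂ)).conjTranspose = entryMoment N a b := by
  ext f g
  conv_rhs => rw [entryMoment, Matrix.of_apply, ← integral_mul_left_eq_self _ V]
  have hint : ∀ (f : J → Fin N) (g : J' → Fin N), Integrable
      (fun U : Matrix.unitaryGroup (Fin N) ℂ =>
        (∏ i, (U : Matrix (Fin N) (Fin N) ℂ) (f i) (a i)) *
        ∏ j, star ((U : Matrix (Fin N) (Fin N) ℂ) (g j) (b j))) (haarUnitary N) := fun f g =>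
    integrable_haarUnitary (by fun_prop)
  have hexp : ∀ U : Matrix.unitaryGroup (Fin N) ℂ,
      (∏ i, ((V * U : Matrix.unitaryGroup (Fin N) ℂ) : Matrix (Fin N) (Fin N) ℂ) (f i) (a i)) *
        ∏ j, star (((V * U : Matrix.unitaryGroup (Fin N) ℂ) : Matrix (Fin N) (Fin N) ℂ)
          (g j) (b j)) =
      ∑ g', ∑ f', tensorPower J (V : Matrix (Fin N) (Fin N) ℂ) f f' *
        ((∏ i, (U : Matrix (Fin N) (Fin N) ℂ) (f' i) (a i)) *
        ∏ j, star ((U : Matrix (Fin N) (Fin N) ℂ) (g' j) (b j))) *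
        star (tensorPower J' (V : Matrix (Fin N) (Fin N) ℂ) g g') := by
    intro U
    have h1 := congrFun (congrFun (tensorPower_mul (J := J) (V : Matrix (Fin N) (Fin N) ℂ) U) f) a
    have h2 := congrFun (congrFun (tensorPower_mul (J := J') (V : Matrix (Fin N) (Fin N) ℂ) U) g) b
    rw [tensorPower_apply, Matrix.mul_apply] at h1 h2
    have h3 := congrArg star h2
    rw [star_prod, star_sum] at h3
    rw [Submonoid.coe_mul, h1, h3, Finset.sum_mul_sum, Finset.sum_comm]
    refine Finset.sum_congr rfl fun g' _ => Finset.sum_congr rfl fun f' _ => ?_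
    simp only [tensorPower_apply, star_mul', star_prod]
    ring
  simp only [hexp]
  rw [integral_finsetSum _ fun g' _ => integrable_finsetSum _ fun f' _ =>
    ((hint _ _).const_mul _).mul_const _, Matrix.mul_apply]
  refine Finset.sum_congr rfl fun g' _ => ?_
  rw [integral_finsetSum _ fun f' _ => ((hint _ _).const_mul _).mul_const _, Matrix.mul_apply,
    Finset.sum_mul]
  refine Finset.sum_congr rfl fun f' _ => ?_
  rw [integral_mul_const, integral_const_mul]
  rfl

theorem tensorPower_mul_entryMoment (a : J → Fin N) (b : J' → Fin N) :
    ∀ V ∈ Matrix.unitaryGroup (Fin N) ℂ,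
      tensorPower J V * entryMoment N a b = entryMoment N a b * tensorPower J' V := by
  intro V hV
  have h := tensorPower_mul_entryMoment_mul a b ⟨V, hV⟩
  conv_rhs => rw [← h]
  rw [Matrix.mul_assoc _ _ (tensorPower J' V), ← tensorPower_conjTranspose, ← tensorPower_mul]
  have : V.conjTranspose * V = 1 := Matrix.mem_unitaryGroup_iff'.mp hV
  rw [this, tensorPower_one, Matrix.mul_one]

/-- Averages of products of traces of permuted tensor powers count conjugating bijections. -/
theorem integral_trace_perm (hJ : Fintype.card J' ≤ N) (α : Equiv.Perm J) (β : Equiv.Perm J') :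
    ∫ U : Matrix.unitaryGroup (Fin N) ℂ,
      (∑ f : J → Fin N, ∏ i, (U : Matrix (Fin N) (Fin N) ℂ) (f i) (f (α i))) *
        star (∑ g : J' → Fin N, ∏ j, (U : Matrix (Fin N) (Fin N) ℂ) (g j) (g (β j)))
        ∂(haarUnitary N) =
      (Fintype.card {σ : J ≃ J' // ∀ i, σ (α i) = β (σ i)} : ℂ) := by
  obtain ⟨e⟩ : Nonempty (J' ↪ Fin N) :=
    Function.Embedding.nonempty_of_card_le (by simpa using hJ)
  have h1 : ∀ U : Matrix.unitaryGroup (Fin N) ℂ,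
      (∑ f : J → Fin N, ∏ i, (U : Matrix (Fin N) (Fin N) ℂ) (f i) (f (α i))) *
        star (∑ g : J' → Fin N, ∏ j, (U : Matrix (Fin N) (Fin N) ℂ) (g j) (g (β j))) =
      ∑ g : J' → Fin N, ∑ f : J → Fin N,
        (∏ i, (U : Matrix (Fin N) (Fin N) ℂ) (f i) ((f ∘ α) i)) *
        ∏ j, star ((U : Matrix (Fin N) (Fin N) ℂ) (g j) ((g ∘ β) j)) := by
    intro U
    rw [star_sum, Finset.sum_mul_sum, Finset.sum_comm]
    simp [star_prod]
  simp only [h1]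
  rw [integral_finsetSum _ fun g _ => integrable_finsetSum _ fun f _ =>
    integrable_haarUnitary (by fun_prop)]
  have h2 : ∀ g : J' → Fin N, ∫ U : Matrix.unitaryGroup (Fin N) ℂ, ∑ f : J → Fin N,
        (∏ i, (U : Matrix (Fin N) (Fin N) ℂ) (f i) ((f ∘ α) i)) *
        ∏ j, star ((U : Matrix (Fin N) (Fin N) ℂ) (g j) ((g ∘ β) j)) ∂(haarUnitary N) =
      ∑ σ : J ≃ J', entryMoment N (g ∘ σ ∘ α) (g ∘ β) (e ∘ σ) e := by
    intro g
    rw [integral_finsetSum _ fun f _ => integrable_haarUnitary (by fun_prop)]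
    -- The column labels f ∘ α and g ∘ β depend on the row labels; they are frozen while the
    -- commutant expansion is applied and then evaluated at f = g ∘ σ.
    have h3 : ∀ f : J → Fin N, ∫ U : Matrix.unitaryGroup (Fin N) ℂ,
        (∏ i, (U : Matrix (Fin N) (Fin N) ℂ) (f i) ((f ∘ α) i)) *
        ∏ j, star ((U : Matrix (Fin N) (Fin N) ℂ) (g j) ((g ∘ β) j)) ∂(haarUnitary N) =
        ∑ σ : J ≃ J', if f = g ∘ σ then
          entryMoment N (f ∘ α) (g ∘ β) (e ∘ σ) e else 0 := fun f =>
      apply_eq_sum_equiv_of_commute_unitary (tensorPower_mul_entryMoment (f ∘ α) (g ∘ β))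
        e.injective f g
    simp only [h3]
    rw [Finset.sum_comm]
    refine Finset.sum_congr rfl fun σ _ => ?_
    rw [Finset.sum_ite_eq' Finset.univ, if_pos (Finset.mem_univ _)]
    rfl
  simp only [h2]
  rw [Finset.sum_comm]
  have h4 : ∀ σ : J ≃ J', ∑ g : J' → Fin N, entryMoment N (g ∘ σ ∘ α) (g ∘ β) (e ∘ σ) e =
      if ∀ i, σ (α i) = β (σ i) then 1 else 0 := by
    intro σ
    -- Substituting g = h ∘ β⁻¹ brings the sum to the form of `sum_entryMoment_comp` with τ = β⁻¹σα;
    -- injectivity of e then reads e ∘ σ = e ∘ τ as σ = τ.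
    rw [← (Equiv.arrowCongr β (Equiv.refl (Fin N))).sum_comp]
    have h5 : ∀ h : J' → Fin N,
        entryMoment N ((Equiv.arrowCongr β (Equiv.refl (Fin N))) h ∘ σ ∘ α)
          ((Equiv.arrowCongr β (Equiv.refl (Fin N))) h ∘ β) (e ∘ σ) e =
        entryMoment N (h ∘ ((α.trans σ).trans β.symm)) h (e ∘ σ) e := by
      intro h
      have e1 : (Equiv.arrowCongr β (Equiv.refl (Fin N))) h ∘ β = h := by
        ext j
        simp
      have e2 : (Equiv.arrowCongr β (Equiv.refl (Fin N))) h ∘ σ ∘ α =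
          h ∘ ((α.trans σ).trans β.symm) := by
        ext j
        simp
      rw [e1, e2]
    simp only [h5]
    rw [sum_entryMoment_comp]
    refine if_congr ?_ rfl rfl
    rw [funext_iff]
    refine forall_congr' fun i => ?_
    simp only [Function.comp_apply, e.injective.eq_iff, Equiv.trans_apply]
    rw [Equiv.eq_symm_apply, eq_comm]
  simp only [h4]
  rw [Finset.sum_boole, Fintype.card_subtype]

end Moments

/-! ### Bijections intertwining two permutations in cycle form -/

section Cycles

variable {P Q : Type*} (m : P → ℕ) (m' : Q → ℕ)

/-- The permutation with one cycle of length `m p` for every `p`. -/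
def sigmaCycle : Equiv.Perm (Σ p, ZMod (m p)) :=
  Equiv.sigmaCongrRight fun _ => Equiv.addRight 1

theorem sigmaCycle_apply (x : Σ p, ZMod (m p)) : sigmaCycle m x = ⟨x.1, x.2 + 1⟩ := rfl

variable {m m'}

/-- The intertwiner of two permutations in cycle form attached to a bijection of their cycles and a
rotation of every cycle. -/
def cycleEquiv (π : {π : P ≃ Q // ∀ p, m' (π p) = m p}) (r : ∀ p, ZMod (m' (π.1 p))) :
    (Σ p, ZMod (m p)) ≃ Σ q, ZMod (m' q) :=
  Equiv.sigmaCongr π.1 fun p =>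
    (ZMod.ringEquivCongr (π.2 p).symm).toEquiv.trans (Equiv.addLeft (r p))

theorem cycleEquiv_apply (π : {π : P ≃ Q // ∀ p, m' (π p) = m p})
    (r : ∀ p, ZMod (m' (π.1 p))) (x : Σ p, ZMod (m p)) :
    cycleEquiv π r x = ⟨π.1 x.1, r x.1 + ZMod.ringEquivCongr (π.2 x.1).symm x.2⟩ := rfl

/-- An intertwiner is determined by the images of the base points 0 of the cycles. -/
theorem intertwiner_apply_natCast {σ : (Σ p, ZMod (m p)) ≃ Σ q, ZMod (m' q)}
    (hσ : ∀ x, σ (sigmaCycle m x) = sigmaCycle m' (σ x)) (p : P) (n : ℕ) :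
    σ ⟨p, n⟩ = ⟨(σ ⟨p, 0⟩).1, (σ ⟨p, 0⟩).2 + n⟩ := by
  induction n with
  | zero => simp
  | succ n ih =>
    have := hσ ⟨p, n⟩
    rw [sigmaCycle_apply, ih, sigmaCycle_apply] at this
    simpa [add_assoc] using this

theorem cycleEquiv_intertwines (π : {π : P ≃ Q // ∀ p, m' (π p) = m p})
    (r : ∀ p, ZMod (m' (π.1 p))) (x : Σ p, ZMod (m p)) :
    cycleEquiv π r (sigmaCycle m x) = sigmaCycle m' (cycleEquiv π r x) := by
  simp only [cycleEquiv_apply, sigmaCycle_apply, map_add, map_one, add_assoc]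

theorem cycleEquiv_injective :
    Function.Injective fun s : Σ π : {π : P ≃ Q // ∀ p, m' (π p) = m p}, ∀ p, ZMod (m' (π.1 p)) =>
      cycleEquiv s.1 s.2 := by
  rintro ⟨⟨π, hπ⟩, r⟩ ⟨⟨π', hπ'⟩, r'⟩ h
  have h0 : ∀ p, (⟨π p, r p⟩ : Σ q, ZMod (m' q)) = ⟨π' p, r' p⟩ := by
    intro p
    have := congrArg (fun σ : (Σ p, ZMod (m p)) ≃ Σ q, ZMod (m' q) => σ ⟨p, 0⟩) h
    simpa [cycleEquiv_apply] using this
  have hππ : π = π' := by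
    ext1 p
    exact congrArg Sigma.fst (h0 p)
  subst hππ
  have hrr : r = r' := by
    funext p
    simpa using h0 p
  subst hrr
  rfl

variable [∀ p, NeZero (m p)] [∀ q, NeZero (m' q)]

/-- The images of the base points give the map of cycles and the rotations. Base points sent to one
cycle differ there by a shift, which pulls back to a shift within a single source cycle, so the map
is injective; corresponding lengths divide each other. -/
theorem exists_cycleEquiv_eq {σ : (Σ p, ZMod (m p)) ≃ Σ q, ZMod (m' q)}
    (hσ : ∀ x, σ (sigmaCycle m x) = sigmaCycle m' (σ x)) :
    ∃ π r, cycleEquiv (m := m) (m' := m') π r = σ := by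
  have hnat := intertwiner_apply_natCast hσ
  have hval : ∀ {k : ℕ} [NeZero k] (x : ZMod k), ((x.val : ℕ) : ZMod k) = x :=
    fun x => ZMod.natCast_zmod_val x
  have hbij : Function.Bijective fun p => (σ ⟨p, 0⟩).1 := by
    constructor
    · intro p p' hpp
      obtain ⟨⟨q, r⟩, hs⟩ : ∃ s, σ ⟨p, 0⟩ = s := ⟨_, rfl⟩
      obtain ⟨⟨q', r'⟩, hs'⟩ : ∃ s, σ ⟨p', 0⟩ = s := ⟨_, rfl⟩
      simp only [hs, hs'] at hpp
      subst hpp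
      have h1 := hnat p (r' - r).val
      have h2 : r + ((r' - r).val : ZMod (m' q)) = r' := by
        rw [ZMod.natCast_zmod_val, add_sub_cancel]
      rw [hs] at h1
      simp only [h2] at h1
      rw [← hs'] at h1
      exact congrArg Sigma.fst (σ.injective h1)
    · intro q
      obtain ⟨⟨p, x⟩, hs⟩ : ∃ s, σ.symm ⟨q, 0⟩ = s := ⟨_, rfl⟩
      refine ⟨p, ?_⟩
      have h1 := hnat p x.val
      rw [hval, ← hs, Equiv.apply_symm_apply] at h1
      exact (congrArg Sigma.fst h1).symm
  set π : P ≃ Q := Equiv.ofBijective _ hbij with hπ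
  have hlen : ∀ p, m' (π p) = m p := by
    intro p
    obtain ⟨⟨q, r⟩, hs⟩ : ∃ s, σ ⟨p, 0⟩ = s := ⟨_, rfl⟩
    have hq : π p = q := by
      rw [hπ, Equiv.ofBijective_apply, hs]
    rw [hq]
    refine Nat.dvd_antisymm ?_ ?_
    · have h1 := hnat p (m p)
      rw [ZMod.natCast_self, hs] at h1
      simp only [Sigma.mk.injEq, heq_eq_eq, true_and] at h1
      rw [← ZMod.natCast_eq_zero_iff]
      simpa using h1
    · have h1 := hnat p (m' q)
      rw [hs] at h1
      simp only [ZMod.natCast_self, add_zero] at h1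
      rw [← hs] at h1
      have h2 := σ.injective h1
      simp only [Sigma.mk.injEq, heq_eq_eq, true_and] at h2
      rwa [ZMod.natCast_eq_zero_iff] at h2
  refine ⟨⟨π, hlen⟩, fun p => (σ ⟨p, 0⟩).2, ?_⟩
  ext1 ⟨p, x⟩
  have h1 := hnat p x.val
  rw [hval] at h1
  have hlen' : m p = m' (σ ⟨p, 0⟩).1 := (hlen p).symm
  have h2 : ZMod.ringEquivCongr hlen' x = x.val := by
    conv_lhs => rw [← hval x]
    exact map_natCast _ _
  change (⟨(σ ⟨p, 0⟩).1, (σ ⟨p, 0⟩).2 + ZMod.ringEquivCongr hlen' x⟩ : Σ q, ZMod (m' q)) = _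
  rw [h1, h2]

open Classical in
theorem card_intertwiners [Fintype P] [Fintype Q] :
    Fintype.card {σ : (Σ p, ZMod (m p)) ≃ Σ q, ZMod (m' q) //
      ∀ x, σ (sigmaCycle m x) = sigmaCycle m' (σ x)} =
    Fintype.card {π : P ≃ Q // ∀ p, m' (π p) = m p} * ∏ p, m p := by
  have h1 : Function.Bijective fun s : (Σ π : {π : P ≃ Q // ∀ p, m' (π p) = m p},
      ∀ p, ZMod (m' (π.1 p))) => (⟨cycleEquiv s.1 s.2, cycleEquiv_intertwines s.1 s.2⟩ :
      {σ : (Σ p, ZMod (m p)) ≃ Σ q, ZMod (m' q) //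
        ∀ x, σ (sigmaCycle m x) = sigmaCycle m' (σ x)}) := by
    constructor
    · intro s t hst
      exact cycleEquiv_injective (congrArg Subtype.val hst)
    · rintro ⟨σ, hσ⟩
      obtain ⟨π, r, h⟩ := exists_cycleEquiv_eq hσ
      exact ⟨⟨π, r⟩, Subtype.ext h⟩
  rw [← Fintype.card_of_bijective h1, Fintype.card_sigma]
  have h2 : ∀ π : {π : P ≃ Q // ∀ p, m' (π p) = m p},
      Fintype.card (∀ p, ZMod (m' (π.1 p))) = ∏ p, m p := by
    intro π
    rw [Fintype.card_pi]
    refine Finset.prod_congr rfl fun p _ => ?_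
    rw [ZMod.card, π.2]
  simp only [h2]
  rw [Finset.sum_const, smul_eq_mul, Finset.card_univ]

end Cycles

open Classical in
/-- The Diaconis–Shahshahani formula for moments of traces of powers. -/
theorem integral_prod_trace_pow {N : ℕ} {P Q : Type*} [Fintype P] [Fintype Q] (m : P → ℕ)
    (m' : Q → ℕ) [∀ p, NeZero (m p)] [∀ q, NeZero (m' q)] (hN : ∑ q, m' q ≤ N) :
    ∫ U : Matrix.unitaryGroup (Fin N) ℂ,
      (∏ p, ((U : Matrix (Fin N) (Fin N) ℂ) ^ m p).trace) *
        star (∏ q, ((U : Matrix (Fin N) (Fin N) ℂ) ^ m' q).trace) ∂(haarUnitary N) =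
      (Nat.card {π : P ≃ Q // ∀ p, m' (π p) = m p} : ℂ) * ∏ p, (m p : ℂ) := by
  simp only [← sum_prod_sigma_cycle]
  have h := integral_trace_perm (N := N) (J := Σ p, ZMod (m p)) (J' := Σ q, ZMod (m' q))
    (by simpa [Fintype.card_sigma, ZMod.card] using hN) (sigmaCycle m) (sigmaCycle m')
  rw [card_intertwiners] at h
  rw [Nat.card_eq_fintype_card]
  push_cast at h
  exact h

/-! ### Traces of powers and eigenvalues -/

section CharpolyPow

variable {n K : Type*} [Fintype n] [DecidableEq n] [Field K] [IsAlgClosed K]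

-- Both sides are multiplicative in q, so constants and linear factors suffice, and for the latter
-- this is the characteristic polynomial itself. Taking q = z - X^m gives the eigenvalues of A^m
-- with multiplicity.
open Polynomial in
theorem det_aeval_eq_prod_roots (A : Matrix n n K) (q : K[X]) :
    (aeval A q).det = (A.charpoly.roots.map fun r => q.eval r).prod := by
  set R := A.charpoly.roots with hR
  have hcard : R.card = Fintype.card n := by
    rw [hR, ← (IsAlgClosed.splits _).natDegree_eq_card_roots, Matrix.charpoly_natDegree_eq_dim]
  have hchar : A.charpoly = (R.map fun r => X - C r).prod :=
    (IsAlgClosed.splits _).eq_prod_roots_of_monic A.charpoly_monic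
  have hlin : ∀ s : K, (aeval A (X - C s)).det = (R.map fun r => (X - C s).eval r).prod := by
    intro s
    have h1 : A.charpoly.eval s = (Matrix.scalar n s - A).det := Matrix.eval_charpoly A s
    have h2 : aeval A (X - C s) = -(Matrix.scalar n s - A) := by
      rw [map_sub, aeval_X, aeval_C, neg_sub, Matrix.algebraMap_eq_diagonal]
      rfl
    rw [h2, Matrix.det_neg, ← h1, hchar, eval_multiset_prod, Multiset.map_map, ← hcard]
    have h3 : R.map (fun r => (X - C s).eval r) =
        R.map fun r => (-1) * ((eval s ∘ fun r => X - C r) r) := by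
      refine Multiset.map_congr rfl fun r _ => ?_
      simp
    rw [h3, Multiset.prod_map_mul, Multiset.map_const', Multiset.prod_replicate]
  have hsplit := (IsAlgClosed.splits q).eq_prod_roots
  rw [hsplit]
  set c := q.leadingCoeff
  generalize q.roots = S
  induction S using Multiset.induction_on with
  | empty =>
    simp [Multiset.map_const', hcard, Matrix.algebraMap_eq_diagonal]
  | cons s S ih =>
    rw [Multiset.map_cons, Multiset.prod_cons, mul_left_comm, map_mul, Matrix.det_mul, ih, hlin,
      ← Multiset.prod_map_mul]
    refine congrArg _ (Multiset.map_congr rfl fun r _ => ?_)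
    simp only [eval_mul]

open Polynomial in
theorem charpoly_pow_roots (A : Matrix n n K) (m : ℕ) :
    (A ^ m).charpoly.roots = A.charpoly.roots.map (· ^ m) := by
  have h : (A ^ m).charpoly = ((A.charpoly.roots.map (· ^ m)).map fun r => X - C r).prod := by
    refine Polynomial.funext fun z => ?_
    rw [Matrix.eval_charpoly, eval_multiset_prod, Multiset.map_map, Multiset.map_map]
    have h1 := det_aeval_eq_prod_roots A (C z - X ^ m)
    rw [map_sub, map_pow, aeval_X, aeval_C, Matrix.algebraMap_eq_diagonal] at h1
    refine Eq.trans h1 ?_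
    refine congrArg _ (Multiset.map_congr rfl fun r _ => ?_)
    simp
  rw [h, roots_multiset_prod_X_sub_C]

theorem trace_pow_eq_sum_roots (A : Matrix n n K) (m : ℕ) :
    (A ^ m).trace = (A.charpoly.roots.map (· ^ m)).sum := by
  rw [Matrix.trace_eq_sum_roots_charpoly, charpoly_pow_roots]

end CharpolyPow

/-- `tr U^k`, for integral `k`. -/
def tracePow {N : ℕ} (U : Matrix.unitaryGroup (Fin N) ℂ) (k : ℤ) : ℂ :=
  ((U ^ k : Matrix.unitaryGroup (Fin N) ℂ) : Matrix (Fin N) (Fin N) ℂ).trace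

theorem tracePow_natCast {N : ℕ} (U : Matrix.unitaryGroup (Fin N) ℂ) (k : ℕ) :
    tracePow U k = ((U : Matrix (Fin N) (Fin N) ℂ) ^ k).trace := by
  simp [tracePow]

theorem tracePow_neg {N : ℕ} (U : Matrix.unitaryGroup (Fin N) ℂ) (k : ℤ) :
    tracePow U (-k) = star (tracePow U k) := by
  rw [tracePow, tracePow, zpow_neg, ← Matrix.trace_conjTranspose]
  rfl

theorem tracePow_zero {N : ℕ} (U : Matrix.unitaryGroup (Fin N) ℂ) : tracePow U 0 = N := by
  simp [tracePow]

@[fun_prop]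
theorem continuous_tracePow {N : ℕ} (k : ℤ) :
    Continuous fun U : Matrix.unitaryGroup (Fin N) ℂ => tracePow U k := by
  unfold tracePow Matrix.trace
  refine continuous_finsetSum _ fun i _ => ?_
  exact (continuous_unitaryGroup_apply i i).comp (continuous_zpow k)

theorem tracePow_eq_sum_exp {N : ℕ} (U : Matrix.unitaryGroup (Fin N) ℂ) {θ : Fin N → ℝ}
    (hθ : IsEigenangles (U : Matrix (Fin N) (Fin N) ℂ) θ) (k : ℤ) :
    tracePow U k = ∑ j, Complex.exp (2 * Real.pi * Complex.I * (k * θ j : ℝ)) := by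
  have hnat : ∀ k : ℕ, tracePow U k = ∑ j, Complex.exp (2 * Real.pi * Complex.I * (k * θ j : ℝ)) := by
    intro k
    rw [tracePow_natCast, trace_pow_eq_sum_roots, hθ, Multiset.map_map]
    refine Finset.sum_congr rfl fun j _ => ?_
    rw [Function.comp_apply, ← Complex.exp_nat_mul]
    congr 1
    push_cast
    ring
  obtain ⟨k, rfl | rfl⟩ := k.eq_nat_or_neg
  · simpa using hnat k
  · rw [tracePow_neg, hnat, star_sum]
    refine Finset.sum_congr rfl fun j _ => ?_
    rw [Complex.star_def, ← Complex.exp_conj]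
    congr 1
    simp [Complex.conj_ofNat]

/-! ### Pairings of indices -/

section Pairings

variable {n : ℕ} {σ : Finset (Fin n × Fin n)} {k : Fin n → ℤ}

/-- A set of pairwise disjoint pairs `(α, β)` with `α < β`. -/
def IsPairing (σ : Finset (Fin n × Fin n)) : Prop :=
  (∀ p ∈ σ, p.1 < p.2) ∧
    ∀ p ∈ σ, ∀ q ∈ σ, p ≠ q → p.1 ≠ q.1 ∧ p.1 ≠ q.2 ∧ p.2 ≠ q.1 ∧ p.2 ≠ q.2

/-- The pairs in `σ` have opposite values under `k`, and exhaust the support of `k`. -/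
def Compatible (σ : Finset (Fin n × Fin n)) (k : Fin n → ℤ) : Prop :=
  (∀ p ∈ σ, k p.1 + k p.2 = 0) ∧ ∀ i, k i ≠ 0 ↔ ∃ p ∈ σ, i = p.1 ∨ i = p.2

theorem IsPairing.eq_of_mem (hσ : IsPairing σ) {p q : Fin n × Fin n} (hp : p ∈ σ) (hq : q ∈ σ)
    {i : Fin n} (hip : i = p.1 ∨ i = p.2) (hiq : i = q.1 ∨ i = q.2) : p = q := by
  by_contra hpq
  have := hσ.2 p hp q hq hpq
  rcases hip with rfl | rfl <;> rcases hiq with h | h <;> tauto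

/-- The index of a pair at which `k` is positive. -/
def pairPos (k : Fin n → ℤ) (p : Fin n × Fin n) : Fin n := if 0 < k p.1 then p.1 else p.2

/-- The index of a pair at which `k` is not positive. -/
def pairNeg (k : Fin n → ℤ) (p : Fin n × Fin n) : Fin n := if 0 < k p.1 then p.2 else p.1

theorem Compatible.ne_zero (hk : Compatible σ k) {p : Fin n × Fin n} (hp : p ∈ σ) :
    k p.1 ≠ 0 ∧ k p.2 ≠ 0 :=
  ⟨(hk.2 _).mpr ⟨p, hp, Or.inl rfl⟩, (hk.2 _).mpr ⟨p, hp, Or.inr rfl⟩⟩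

theorem Compatible.pairPos_pos (hk : Compatible σ k) {p : Fin n × Fin n} (hp : p ∈ σ) :
    0 < k (pairPos k p) := by
  have h1 := hk.1 p hp
  have h2 := hk.ne_zero hp
  unfold pairPos
  split_ifs <;> omega

theorem Compatible.pairNeg_neg (hk : Compatible σ k) {p : Fin n × Fin n} (hp : p ∈ σ) :
    k (pairNeg k p) < 0 := by
  have h1 := hk.1 p hp
  have h2 := hk.ne_zero hp
  unfold pairNeg
  split_ifs <;> omega

theorem Compatible.add_eq_zero (hk : Compatible σ k) {p : Fin n × Fin n} (hp : p ∈ σ) :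
    k (pairPos k p) + k (pairNeg k p) = 0 := by
  have h1 := hk.1 p hp
  unfold pairPos pairNeg
  split_ifs <;> omega

theorem Compatible.natAbs_pairPos (hk : Compatible σ k) {p : Fin n × Fin n} (hp : p ∈ σ) :
    (k (pairPos k p)).natAbs = (k p.1).natAbs := by
  have h1 := hk.1 p hp
  unfold pairPos
  split_ifs <;> omega

theorem pairPos_eq_or (k : Fin n → ℤ) (p : Fin n × Fin n) :
    pairPos k p = p.1 ∨ pairPos k p = p.2 := by
  unfold pairPos
  split_ifs <;> simp

theorem pairNeg_eq_or (k : Fin n → ℤ) (p : Fin n × Fin n) :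
    pairNeg k p = p.1 ∨ pairNeg k p = p.2 := by
  unfold pairNeg
  split_ifs <;> simp

theorem min_max_pairPos_pairNeg (k : Fin n → ℤ) {p : Fin n × Fin n} (hp : p.1 < p.2) :
    (min (pairPos k p) (pairNeg k p), max (pairPos k p) (pairNeg k p)) = p := by
  unfold pairPos pairNeg
  split_ifs
  · rw [min_eq_left hp.le, max_eq_right hp.le]
  · rw [min_eq_right hp.le, max_eq_left hp.le]

/-- Every positive index lies in exactly one pair, whose other member is negative. -/
theorem bijective_pairPos (hσ : IsPairing σ) (hk : Compatible σ k) :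
    Function.Bijective fun p : σ => (⟨pairPos k p, hk.pairPos_pos p.2⟩ : {i // 0 < k i}) := by
  constructor
  · intro p q hpq
    have h : pairPos k p = pairPos k q := congrArg Subtype.val hpq
    exact Subtype.ext (hσ.eq_of_mem p.2 q.2 (pairPos_eq_or k p) (h ▸ pairPos_eq_or k q))
  · rintro ⟨i, hi⟩
    obtain ⟨p, hp, hip⟩ := (hk.2 i).mp hi.ne'
    refine ⟨⟨p, hp⟩, Subtype.ext ?_⟩
    have h1 := hk.1 p hp
    simp only [pairPos]
    rcases hip with rfl | rfl <;> split_ifs <;> first | rfl | omega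

theorem bijective_pairNeg (hσ : IsPairing σ) (hk : Compatible σ k) :
    Function.Bijective fun p : σ => (⟨pairNeg k p, hk.pairNeg_neg p.2⟩ : {i // k i < 0}) := by
  constructor
  · intro p q hpq
    have h : pairNeg k p = pairNeg k q := congrArg Subtype.val hpq
    exact Subtype.ext (hσ.eq_of_mem p.2 q.2 (pairNeg_eq_or k p) (h ▸ pairNeg_eq_or k q))
  · rintro ⟨i, hi⟩
    obtain ⟨p, hp, hip⟩ := (hk.2 i).mp hi.ne
    refine ⟨⟨p, hp⟩, Subtype.ext ?_⟩
    have h1 := hk.1 p hp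
    simp only [pairNeg]
    rcases hip with rfl | rfl <;> split_ifs <;> first | rfl | omega

/-- The set of pairs attached to a bijection between the positive and the negative indices. -/
def pairingOfEquiv (π : {i // 0 < k i} ≃ {i // k i < 0}) : Finset (Fin n × Fin n) :=
  Finset.univ.image fun p : {i // 0 < k i} => (min p.1 (π p).1, max p.1 (π p).1)

theorem mem_pairingOfEquiv {π : {i // 0 < k i} ≃ {i // k i < 0}} {s : Fin n × Fin n} :
    s ∈ pairingOfEquiv π ↔ ∃ p, (min p.1 (π p).1, max p.1 (π p).1) = s := by
  simp [pairingOfEquiv]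

theorem eq_or_of_eq_min_max {i a b : Fin n} :
    (i = min a b ∨ i = max a b) ↔ i = a ∨ i = b := by
  rcases le_total a b with h | h <;> simp [h, or_comm]

theorem isPairing_pairingOfEquiv (π : {i // 0 < k i} ≃ {i // k i < 0}) :
    IsPairing (pairingOfEquiv π) := by
  constructor
  · intro s hs
    obtain ⟨p, rfl⟩ := mem_pairingOfEquiv.mp hs
    refine min_lt_max.mpr fun h => ?_
    have h1 := p.2
    have h2 := (π p).2
    rw [← h] at h2
    omega
  · intro s hs t ht hst
    obtain ⟨p, rfl⟩ := mem_pairingOfEquiv.mp hs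
    obtain ⟨q, rfl⟩ := mem_pairingOfEquiv.mp ht
    have hpq : p ≠ q := fun h => hst (by rw [h])
    have key : ∀ i, (i = p.1 ∨ i = (π p).1) → (i = q.1 ∨ i = (π q).1) → False := by
      have h1 := p.2
      have h2 := (π p).2
      have h3 := q.2
      have h4 := (π q).2
      rintro i (rfl | rfl) (h | h)
      · exact hpq (Subtype.ext h)
      · rw [h] at h1
        omega
      · rw [h] at h2
        omega
      · exact hpq (π.injective (Subtype.ext h))
    refine ⟨fun h => ?_, fun h => ?_, fun h => ?_, fun h => ?_⟩
    · exact key _ (eq_or_of_eq_min_max.mp (Or.inl rfl)) (eq_or_of_eq_min_max.mp (Or.inl h))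
    · exact key _ (eq_or_of_eq_min_max.mp (Or.inl rfl)) (eq_or_of_eq_min_max.mp (Or.inr h))
    · exact key _ (eq_or_of_eq_min_max.mp (Or.inr rfl)) (eq_or_of_eq_min_max.mp (Or.inl h))
    · exact key _ (eq_or_of_eq_min_max.mp (Or.inr rfl)) (eq_or_of_eq_min_max.mp (Or.inr h))

theorem compatible_pairingOfEquiv {π : {i // 0 < k i} ≃ {i // k i < 0}}
    (hπ : ∀ p, (k (π p)).natAbs = (k p).natAbs) : Compatible (pairingOfEquiv π) k := by
  constructor
  · intro s hs
    obtain ⟨p, rfl⟩ := mem_pairingOfEquiv.mp hs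
    have h1 := p.2
    have h2 := (π p).2
    have h3 := hπ p
    rcases le_total p.1 (π p).1 with h | h <;> simp only [h, min_eq_left, max_eq_right,
      min_eq_right, max_eq_left] <;> omega
  · intro i
    constructor
    · intro hi
      rcases lt_or_gt_of_ne hi with h | h
      · refine ⟨_, mem_pairingOfEquiv.mpr ⟨π.symm ⟨i, h⟩, rfl⟩, eq_or_of_eq_min_max.mpr (Or.inr ?_)⟩
        simp
      · exact ⟨_, mem_pairingOfEquiv.mpr ⟨⟨i, h⟩, rfl⟩, eq_or_of_eq_min_max.mpr (Or.inl rfl)⟩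
    · rintro ⟨s, hs, hi⟩
      obtain ⟨p, rfl⟩ := mem_pairingOfEquiv.mp hs
      have h1 := p.2
      have h2 := (π p).2
      rcases eq_or_of_eq_min_max.mp hi with rfl | rfl <;> omega

/-- The sign of k tells the two members of a pair apart, so no information is lost by ordering them
by index instead. -/
theorem pairingOfEquiv_injective :
    Function.Injective fun π : {i // 0 < k i} ≃ {i // k i < 0} => pairingOfEquiv π := by
  intro π π' h
  ext1 p
  have h0 : pairingOfEquiv π = pairingOfEquiv π' := h
  have hmem : (min p.1 (π p).1, max p.1 (π p).1) ∈ pairingOfEquiv π' :=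
    h0 ▸ mem_pairingOfEquiv.mpr ⟨p, rfl⟩
  obtain ⟨q, hq⟩ := mem_pairingOfEquiv.mp hmem
  have hq1 := congrArg Prod.fst hq
  have hq2 := congrArg Prod.snd hq
  simp only at hq1 hq2
  have e : ∀ i, (i = q.1 ∨ i = (π' q).1) ↔ (i = p.1 ∨ i = (π p).1) := by
    intro i
    rw [← eq_or_of_eq_min_max, hq1, hq2, eq_or_of_eq_min_max]
  have h1 := p.2
  have h2 := (π p).2
  have h3 := q.2
  have h4 := (π' q).2
  have hqp : q = p := by
    rcases (e q.1).mp (Or.inl rfl) with h | h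
    · exact Subtype.ext h
    · rw [h] at h3
      omega
  subst hqp
  rcases (e (π' q).1).mp (Or.inr rfl) with h | h
  · rw [h] at h4
    omega
  · exact Subtype.ext h.symm

-- Orienting each pair by the sign of k passes between the bijections counted by the moment formula
-- and the pairings that index the main term.
open Classical in
theorem card_compatible_pairings (k : Fin n → ℤ) :
    Nat.card {π : {i // 0 < k i} ≃ {i // k i < 0} // ∀ p, (k (π p)).natAbs = (k p).natAbs} =
      (Finset.univ.filter fun σ : Finset (Fin n × Fin n) =>
        IsPairing σ ∧ Compatible σ k).card := by
  rw [← Fintype.card_subtype, ← Nat.card_eq_fintype_card]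
  refine Nat.card_eq_of_bijective (f := fun π => ⟨pairingOfEquiv π.1,
    isPairing_pairingOfEquiv π.1, compatible_pairingOfEquiv π.2⟩) ⟨fun π π' h => ?_, ?_⟩
  · exact Subtype.ext (pairingOfEquiv_injective (congrArg Subtype.val h))
  · rintro ⟨σ, hσ, hk⟩
    set E := Equiv.ofBijective _ (bijective_pairPos hσ hk) with hE
    set F := Equiv.ofBijective _ (bijective_pairNeg hσ hk) with hF
    have hEF : ∀ p, ∃ s : σ, p = ⟨pairPos k s, hk.pairPos_pos s.2⟩ ∧
        (E.symm.trans F) p = ⟨pairNeg k s, hk.pairNeg_neg s.2⟩ := by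
      intro p
      obtain ⟨s, rfl⟩ := E.surjective p
      exact ⟨s, rfl, by simp [hF]⟩
    refine ⟨⟨E.symm.trans F, fun p => ?_⟩, Subtype.ext ?_⟩
    · obtain ⟨s, h1, h2⟩ := hEF p
      rw [h2, h1]
      have := hk.add_eq_zero s.2
      simp only
      omega
    · ext t
      simp only [mem_pairingOfEquiv]
      constructor
      · rintro ⟨p, rfl⟩
        obtain ⟨s, h1, h2⟩ := hEF p
        rw [h2, h1]
        simp only
        rw [min_max_pairPos_pairNeg k (hσ.1 _ s.2)]
        exact s.2
      · intro ht
        refine ⟨E ⟨t, ht⟩, ?_⟩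
        obtain ⟨s, h1, h2⟩ := hEF (E ⟨t, ht⟩)
        have h3 : s = ⟨t, ht⟩ := E.injective h1.symm
        subst h3
        rw [h2, h1]
        exact min_max_pairPos_pairNeg k (hσ.1 _ ht)

theorem Compatible.prod_natAbs (hσ : IsPairing σ) (hk : Compatible σ k) :
    ∏ p : {i // 0 < k i}, (k p).natAbs = ∏ p ∈ σ, (k p.1).natAbs := by
  rw [← (Equiv.ofBijective _ (bijective_pairPos hσ hk)).prod_comp, ← Finset.prod_coe_sort σ]
  exact Finset.prod_congr rfl fun p _ => hk.natAbs_pairPos p.2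

theorem Compatible.card_zeros (hσ : IsPairing σ) (hk : Compatible σ k) :
    (Finset.univ.filter fun i => k i = 0).card = n - 2 * σ.card := by
  have h1 := Fintype.card_of_bijective (bijective_pairPos hσ hk)
  have h2 := Fintype.card_of_bijective (bijective_pairNeg hσ hk)
  rw [Fintype.card_coe, Fintype.card_subtype] at h1 h2
  have h3 : (Finset.univ.filter fun i => 0 < k i).card + (Finset.univ.filter fun i => k i < 0).card
      + (Finset.univ.filter fun i => k i = 0).card = n := by
    simp only [Finset.card_filter]
    rw [← Finset.sum_add_distrib, ← Finset.sum_add_distrib]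
    have : ∀ i ∈ (Finset.univ : Finset (Fin n)), (if 0 < k i then 1 else 0) +
        (if k i < 0 then 1 else 0) + (if k i = 0 then 1 else 0) = 1 := by
      intro i _
      split_ifs <;> omega
    rw [Finset.sum_congr rfl this]
    simp
  omega

end Pairings

/-- Zero frequencies contribute tr 1 = N and negative ones conjugate traces, which isolates the
mixed moment of Diaconis and Shahshahani. -/
theorem prod_tracePow_eq {n N : ℕ} (U : Matrix.unitaryGroup (Fin N) ℂ) (k : Fin n → ℤ) :
    ∏ i, tracePow U (k i) = (N : ℂ) ^ (Finset.univ.filter fun i => k i = 0).card *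
      ((∏ p : {i // 0 < k i}, ((U : Matrix (Fin N) (Fin N) ℂ) ^ (k p).natAbs).trace) *
        star (∏ q : {i // k i < 0}, ((U : Matrix (Fin N) (Fin N) ℂ) ^ (k q).natAbs).trace)) := by
  have h1 : ∀ i, tracePow U (k i) = (if k i = 0 then (N : ℂ) else 1) *
      ((if 0 < k i then ((U : Matrix (Fin N) (Fin N) ℂ) ^ (k i).natAbs).trace else 1) *
      (if k i < 0 then star ((U : Matrix (Fin N) (Fin N) ℂ) ^ (k i).natAbs).trace else 1)) := by
    intro i
    rcases lt_trichotomy (k i) 0 with h | h | h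
    · rw [if_neg h.ne, if_neg (not_lt.mpr h.le), if_pos h, one_mul, one_mul, ← tracePow_natCast,
        ← tracePow_neg]
      congr 1
      omega
    · rw [if_pos h, if_neg h.not_gt, if_neg h.not_lt, mul_one, mul_one, h, tracePow_zero]
    · rw [if_neg h.ne', if_pos h, if_neg (not_lt.mpr h.le), one_mul, mul_one, ← tracePow_natCast]
      congr 1
      omega
  simp only [h1]
  rw [Finset.prod_mul_distrib, Finset.prod_mul_distrib, ← Finset.prod_filter, Finset.prod_const,
    ← Finset.prod_filter, ← Finset.prod_filter, star_prod]
  congr 2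
  · exact Finset.prod_subtype _ (by simp) _
  · exact Finset.prod_subtype _ (by simp) _

open Classical in
/-- Moments of traces of powers in the stable range, as a sum over pairings. -/
theorem integral_prod_tracePow {n N : ℕ} (k : Fin n → ℤ) (hsum : ∑ i, k i = 0)
    (hN : ∑ i, |k i| ≤ 2 * N) :
    ∫ U : Matrix.unitaryGroup (Fin N) ℂ, ∏ i, tracePow U (k i) ∂(haarUnitary N) =
      ∑ σ : Finset (Fin n × Fin n), if IsPairing σ ∧ Compatible σ k then
        (N : ℂ) ^ (n - 2 * σ.card) * ∏ p ∈ σ, ((k p.1).natAbs : ℂ) else 0 := by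
  have : ∀ p : {i // 0 < k i}, NeZero (k p).natAbs := fun p => ⟨by have := p.2; omega⟩
  have : ∀ p : {i // k i < 0}, NeZero (k p).natAbs := fun p => ⟨by have := p.2; omega⟩
  -- As k sums to zero, its negative part carries exactly half of ∑|k i|. This is how the support
  -- radius 2 yields the stable range.
  have hle : ∑ q : {i // k i < 0}, (k q).natAbs ≤ N := by
    have h1 : ∑ q : {i // k i < 0}, (k q).natAbs = ∑ i, if k i < 0 then (k i).natAbs else 0 := by
      rw [← Finset.sum_filter]
      exact (Finset.sum_subtype _ (by simp) fun i => (k i).natAbs).symm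
    have h2 : ∀ i, |k i| - k i = 2 * ((if k i < 0 then (k i).natAbs else 0 : ℕ) : ℤ) := by
      intro i
      split_ifs <;> rcases abs_cases (k i) with h | h <;> omega
    have h3 : ∑ i, (|k i| - k i) = ∑ i, |k i| := by
      rw [Finset.sum_sub_distrib, hsum, sub_zero]
    rw [← h3] at hN
    simp only [h2] at hN
    rw [← Finset.mul_sum, ← Nat.cast_sum, ← h1] at hN
    omega
  simp only [prod_tracePow_eq]
  rw [integral_const_mul, integral_prod_trace_pow (fun p : {i // 0 < k i} => (k p).natAbs)
    (fun q : {i // k i < 0} => (k q).natAbs) hle, card_compatible_pairings, ← Finset.sum_filter]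
  rw [← nsmul_eq_mul, ← Finset.sum_const, Finset.mul_sum]
  refine Finset.sum_congr rfl fun σ hσ => ?_
  obtain ⟨h1, h2⟩ := (Finset.mem_filter.mp hσ).2
  rw [h2.card_zeros h1, ← Nat.cast_prod, h2.prod_natAbs h1, Nat.cast_prod]

/-! ### Unit cells -/

section Cells

variable {ι : Type*}

/-- The half-open unit cell with lower corner `u`. -/
def unitCell (u : ι → ℤ) : Set (ι → ℝ) := {y | ∀ i, y i ∈ Set.Ioc (u i : ℝ) (u i + 1)}

theorem unitCell_eq_pi (u : ι → ℤ) :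
    unitCell u = Set.univ.pi fun i => Set.Ioc (u i : ℝ) (u i + 1) := by
  ext y
  simp [unitCell]

theorem pairwise_disjoint_unitCell :
    Pairwise (Function.onFun Disjoint (unitCell : (ι → ℤ) → Set (ι → ℝ))) := by
  intro u v huv
  refine Set.disjoint_left.mpr fun y hu hv => huv ?_
  ext i
  have h1 := hu i
  have h2 := hv i
  have h3 : (u i : ℝ) < v i + 1 := h1.1.trans_le h2.2
  have h4 : (v i : ℝ) < u i + 1 := h2.1.trans_le h1.2
  norm_cast at h3 h4
  omega

theorem iUnion_unitCell : ⋃ u, unitCell u = (Set.univ : Set (ι → ℝ)) := by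
  refine Set.eq_univ_of_forall fun y => Set.mem_iUnion.mpr ⟨fun i => ⌈y i⌉ - 1, fun i => ?_⟩
  have h1 := Int.ceil_lt_add_one (y i)
  have h2 := Int.le_ceil (y i)
  constructor <;> push_cast <;> linarith

variable [Fintype ι]

theorem measurableSet_unitCell (u : ι → ℤ) : MeasurableSet (unitCell u) := by
  rw [unitCell_eq_pi]
  exact MeasurableSet.univ_pi fun i => measurableSet_Ioc

theorem volume_unitCell (u : ι → ℤ) : volume (unitCell u) = 1 := by
  rw [unitCell_eq_pi, Real.volume_pi_Ioc]
  simp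

theorem norm_sub_le_one_of_mem_unitCell {u : ι → ℤ} {y : ι → ℝ} (hy : y ∈ unitCell u) :
    ‖y - fun i => (u i : ℝ)‖ ≤ 1 := by
  refine (pi_norm_le_iff_of_nonneg zero_le_one).mpr fun i => ?_
  have := hy i
  rw [Pi.sub_apply, Real.norm_eq_abs, abs_le]
  constructor <;> linarith [this.1, this.2]

variable {E : Type*} [NormedAddCommGroup E] [NormedSpace ℝ E]

theorem hasSum_setIntegral_unitCell {f : (ι → ℝ) → E} (hf : Integrable f) :
    HasSum (fun u : ι → ℤ => ∫ y in unitCell u, f y) (∫ y, f y) := by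
  have := hasSum_integral_iUnion (s := (unitCell : (ι → ℤ) → Set (ι → ℝ))) measurableSet_unitCell
    pairwise_disjoint_unitCell hf.integrableOn
  rwa [iUnion_unitCell, setIntegral_univ] at this

theorem setIntegral_unitCell_zero_add (f : (ι → ℝ) → E) (u : ι → ℤ) :
    ∫ y in unitCell (0 : ι → ℤ), f (y + fun i => (u i : ℝ)) = ∫ y in unitCell u, f y := by
  have h := (measurePreserving_add_right (volume : Measure (ι → ℝ))
    (fun i => (u i : ℝ))).setIntegral_preimage_emb
    (MeasurableEquiv.addRight (fun i => (u i : ℝ))).measurableEmbedding f (unitCell u)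
  rw [← h]
  congr 2
  ext y
  simp only [unitCell, Set.mem_ofPred_eq, Set.mem_preimage, Pi.add_apply, Set.mem_Ioc,
    Pi.zero_apply, Int.cast_zero]
  refine forall_congr' fun i => ?_
  constructor <;> rintro ⟨h1, h2⟩ <;> constructor <;> linarith

end Cells

/-! ### Poisson summation -/

theorem exists_int_of_coe_eq {ι : Type*} {x y : ι → ℝ}
    (h : (fun i => (x i : UnitAddCircle)) = fun i => (y i : UnitAddCircle)) :
    ∃ u : ι → ℤ, x = y + fun i => (u i : ℝ) := by
  have : ∀ i, ∃ n : ℤ, x i = y i + n := by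
    intro i
    have h1 : ((x i - y i : ℝ) : UnitAddCircle) = 0 := by
      rw [AddCircle.coe_sub, sub_eq_zero]
      exact congrFun h i
    obtain ⟨n, hn⟩ := (AddCircle.coe_eq_zero_iff (1 : ℝ)).mp h1
    exact ⟨n, by simp at hn; linarith⟩
  choose u hu using this
  exact ⟨u, funext hu⟩

theorem exists_continuousMap_torus {ι : Type*} {F : (ι → ℝ) → ℂ} (hF : Continuous F)
    (hper : ∀ (y : ι → ℝ) (u : ι → ℤ), F (y + fun i => (u i : ℝ)) = F y) :
    ∃ f : C(UnitAddTorus ι, ℂ), ∀ y : ι → ℝ, f (fun i => (y i : UnitAddCircle)) = F y := by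
  -- A product of open quotient maps is again a quotient map, so continuity descends to the torus.
  have hq : IsOpenQuotientMap (Pi.map fun (_ : ι) (x : ℝ) => (x : UnitAddCircle)) :=
    IsOpenQuotientMap.piMap fun _ => QuotientAddGroup.isOpenQuotientMap_mk
  set f : UnitAddTorus ι → ℂ := fun t => F (Function.surjInv hq.surjective t) with hf
  have hfF : ∀ y : ι → ℝ, f (fun i => (y i : UnitAddCircle)) = F y := by
    intro y
    have h1 := Function.surjInv_eq hq.surjective (fun i => (y i : UnitAddCircle))
    obtain ⟨u, hu⟩ := exists_int_of_coe_eq h1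
    rw [hf]
    simp only
    rw [hu, hper]
  refine ⟨⟨f, hq.continuous_comp_iff.mp ?_⟩, hfF⟩
  exact hF.congr fun y => (hfF y).symm

section Poisson

variable {ι : Type*} [Fintype ι]

/-- Comparison with an integral that converges because p exceeds the dimension: on the cell at u, 1
+ ‖y‖ ≤ 2(1 + ‖u‖), whence the factor 2^p. -/
theorem summable_one_add_norm_int {p : ℕ} (hp : Fintype.card ι < p) :
    Summable fun u : ι → ℤ => ((1 + ‖fun i => (u i : ℝ)‖) ^ p)⁻¹ := by
  have hint : Integrable fun y : ι → ℝ => ((1 + ‖y‖) ^ p)⁻¹ := by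
    have := integrable_one_add_norm (E := ι → ℝ) (μ := volume) (r := p)
      (by simpa using (Nat.cast_lt (α := ℝ)).mpr hp)
    refine this.congr (Filter.Eventually.of_forall fun y => ?_)
    simp only
    rw [Real.rpow_neg (by positivity), Real.rpow_natCast]
  have hs := ((hasSum_setIntegral_unitCell hint).summable).mul_left (2 ^ p)
  refine Summable.of_nonneg_of_le (fun u => by positivity) (fun u => ?_) hs
  have h1 : ∫ y in unitCell u, (2 ^ p)⁻¹ * ((1 + ‖fun i => (u i : ℝ)‖) ^ p)⁻¹ ≤
      ∫ y in unitCell u, ((1 + ‖y‖) ^ p)⁻¹ := by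
    refine setIntegral_mono_on ?_ hint.integrableOn (measurableSet_unitCell u) fun y hy => ?_
    · exact integrableOn_const (by simp [volume_unitCell]) enorm_ne_top
    · rw [← mul_inv, ← mul_pow]
      gcongr
      have h2 := norm_sub_le_one_of_mem_unitCell hy
      have h3 := norm_le_norm_add_norm_sub' y (fun i => (u i : ℝ))
      have h4 := norm_nonneg (fun i => (u i : ℝ))
      linarith
  rw [setIntegral_const, measureReal_def, volume_unitCell] at h1
  simp only [ENNReal.toReal_one, one_smul] at h1
  rwa [inv_mul_le_iff₀ (by positivity)] at h1

/-- The additive character `y ↦ e^{2πi ∑ k_j y_j}`. -/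
def waveExp (k y : ι → ℝ) : ℂ := Complex.exp (2 * Real.pi * Complex.I * (∑ j, k j * y j : ℝ))

theorem norm_waveExp (k y : ι → ℝ) : ‖waveExp k y‖ = 1 := by
  rw [waveExp, mul_assoc, mul_comm Complex.I, ← mul_assoc]
  have := Complex.norm_exp_ofReal_mul_I (2 * Real.pi * ∑ j, k j * y j)
  push_cast at this ⊢
  exact this

theorem waveExp_add_int (k u : ι → ℤ) (y : ι → ℝ) :
    waveExp (fun i => (k i : ℝ)) (y + fun i => (u i : ℝ)) = waveExp (fun i => (k i : ℝ)) y := by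
  refine Complex.exp_eq_exp_iff_exists_int.mpr ⟨∑ j, k j * u j, ?_⟩
  simp only [Pi.add_apply, mul_add, Finset.sum_add_distrib]
  push_cast
  ring

@[fun_prop]
theorem continuous_waveExp (k : ι → ℝ) : Continuous (waveExp k) := by
  unfold waveExp
  fun_prop

theorem mFourier_coe_eq_waveExp (k : ι → ℤ) (y : ι → ℝ) :
    UnitAddTorus.mFourier k (fun i => (y i : UnitAddCircle)) = waveExp (fun i => (k i : ℝ)) y := by
  change ∏ i, fourier (k i) (y i : UnitAddCircle) = _
  simp only [fourier_coe_apply]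
  rw [← Complex.exp_sum, waveExp]
  congr 1
  push_cast
  rw [Finset.mul_sum]
  refine Finset.sum_congr rfl fun i _ => ?_
  simp
  ring

theorem waveExp_neg_int (k : ι → ℤ) (y : ι → ℝ) :
    waveExp (fun i => (((-k) i : ℤ) : ℝ)) y = waveExp (fun i => -(k i : ℝ)) y := by
  simp

/-- By the decay of g the periodization converges locally uniformly and is continuous on the torus.
Characters are invariant under integer shifts, so its Fourier coefficients unfold to integrals over
the whole space; their summability gives pointwise convergence of the series. -/
theorem hasSum_poisson {g : (ι → ℝ) → ℂ} (hg : Continuous g) {C : ℝ} {p : ℕ}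
    (hp : Fintype.card ι < p) (hdecay : ∀ y, (1 + ‖y‖) ^ p * ‖g y‖ ≤ C)
    (hs : Summable fun k : ι → ℤ => ∫ y, waveExp (fun i => -(k i : ℝ)) y * g y) (x : ι → ℝ) :
    HasSum (fun k : ι → ℤ => (∫ y, waveExp (fun i => -(k i : ℝ)) y * g y) *
      waveExp (fun i => (k i : ℝ)) x) (∑' u : ι → ℤ, g (x + fun i => (u i : ℝ))) := by
  have hbound : ∀ y, ‖g y‖ ≤ C * ((1 + ‖y‖) ^ p)⁻¹ := by
    intro y
    rw [← div_eq_mul_inv, le_div_iff₀' (by positivity)]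
    exact hdecay y
  have hC : 0 ≤ C := le_trans (by positivity) (hdecay 0)
  have hgint : Integrable g := by
    have := integrable_one_add_norm (E := ι → ℝ) (μ := volume) (r := p)
      (by simpa using (Nat.cast_lt (α := ℝ)).mpr hp)
    refine (this.const_mul C).mono' hg.aestronglyMeasurable (Filter.Eventually.of_forall fun y => ?_)
    refine (hbound y).trans_eq ?_
    rw [Real.rpow_neg (by positivity), Real.rpow_natCast]
  have hboundR : ∀ (R : ℝ) (y : ι → ℝ) (u : ι → ℤ), ‖y‖ ≤ R →
      ‖g (y + fun i => (u i : ℝ))‖ ≤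
        C * (1 + R) ^ p * ((1 + ‖fun i => (u i : ℝ)‖) ^ p)⁻¹ := by
    intro R y u hy
    refine (hbound _).trans ?_
    rw [mul_assoc]
    refine mul_le_mul_of_nonneg_left ?_ hC
    have hR : 0 ≤ R := (norm_nonneg y).trans hy
    rw [← div_eq_mul_inv, le_div_iff₀ (by positivity), inv_mul_le_iff₀ (by positivity), ← mul_pow]
    gcongr
    have h3 : ‖fun i => (u i : ℝ)‖ ≤ ‖y + fun i => (u i : ℝ)‖ + ‖y‖ := by
      have := norm_sub_le (y + fun i => (u i : ℝ)) y
      rwa [add_sub_cancel_left] at this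
    nlinarith [norm_nonneg (y + fun i => (u i : ℝ))]
  have hsummR : ∀ R : ℝ, Summable fun u : ι → ℤ =>
      C * (1 + R) ^ p * ((1 + ‖fun i => (u i : ℝ)‖) ^ p)⁻¹ := fun R =>
    (summable_one_add_norm_int hp).mul_left _
  set F : (ι → ℝ) → ℂ := fun y => ∑' u : ι → ℤ, g (y + fun i => (u i : ℝ)) with hFdef
  have hFcont : Continuous F := by
    refine continuous_iff_continuousAt.mpr fun y => ?_
    have hball : Metric.ball (0 : ι → ℝ) (‖y‖ + 1) ∈ nhds y :=
      Metric.isOpen_ball.mem_nhds (by simp)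
    refine ContinuousOn.continuousAt ?_ hball
    refine continuousOn_tsum (fun u => by fun_prop) (hsummR (‖y‖ + 1)) fun u z hz => ?_
    exact hboundR _ z u (by simpa using (Metric.mem_ball.mp hz).le)
  have hFper : ∀ (y : ι → ℝ) (v : ι → ℤ), F (y + fun i => (v i : ℝ)) = F y := by
    intro y v
    simp only [hFdef]
    rw [← (Equiv.addLeft v).tsum_eq fun u : ι → ℤ => g (y + fun i => (u i : ℝ))]
    refine tsum_congr fun u => ?_
    congr 1
    ext i
    simp [add_assoc]
  obtain ⟨f, hf⟩ := exists_continuousMap_torus hFcont hFper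
  have hcoeff : ∀ k : ι → ℤ, UnitAddTorus.mFourierCoeff f k =
      ∫ y, waveExp (fun i => -(k i : ℝ)) y * g y := by
    intro k
    rw [UnitAddTorus.mFourierCoeff_eq_integral f k (fun i => ((0 : ι → ℤ) i : ℝ))]
    change ∫ y in unitCell (0 : ι → ℤ), _ = _
    set h : (ι → ℝ) → ℂ := fun y => waveExp (fun i => -(k i : ℝ)) y * g y with hh
    have hhint : Integrable h := by
      refine hgint.mono (by fun_prop) (Filter.Eventually.of_forall fun y => ?_)
      rw [hh, norm_mul, norm_waveExp, one_mul]
    have hterm : ∀ (y : ι → ℝ) (u : ι → ℤ), h (y + fun i => (u i : ℝ)) =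
        waveExp (fun i => -(k i : ℝ)) y * g (y + fun i => (u i : ℝ)) := by
      intro y u
      simp only [hh]
      rw [← waveExp_neg_int, waveExp_add_int, waveExp_neg_int]
    have h1 : ∀ y : ι → ℝ, UnitAddTorus.mFourier (-k) (fun i => (y i : UnitAddCircle)) •
        f (fun i => (y i : UnitAddCircle)) = ∑' u : ι → ℤ, h (y + fun i => (u i : ℝ)) := by
      intro y
      rw [mFourier_coe_eq_waveExp, hf, waveExp_neg_int, smul_eq_mul, hFdef, ← tsum_mul_left]
      exact tsum_congr fun u => (hterm y u).symm
    simp only [h1]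
    rw [← integral_tsum_of_summable_integral_norm]
    · simp only [setIntegral_unitCell_zero_add]
      exact (hasSum_setIntegral_unitCell hhint).tsum_eq
    · intro u
      exact (hhint.comp_add_right (fun i => (u i : ℝ))).integrableOn
    · simp only [setIntegral_unitCell_zero_add (fun y => ‖h y‖)]
      exact (hasSum_setIntegral_unitCell hhint.norm).summable
  have hs' : Summable (UnitAddTorus.mFourierCoeff f) := by
    rwa [funext hcoeff]
  have := UnitAddTorus.hasSum_mFourier_series_apply_of_summable hs'
    (fun i => (x i : UnitAddCircle))
  simp only [hcoeff, hf, mFourier_coe_eq_waveExp, smul_eq_mul] at this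
  exact this

end Poisson

/-! ### Riemann sums -/

section Riemann

variable {ι : Type*} [Fintype ι]

theorem hasCompactSupport_of_eq_zero {G : (ι → ℝ) → ℂ} (hsupp : ∀ x, 1 < ‖x‖ → G x = 0) :
    HasCompactSupport G := by
  refine HasCompactSupport.intro (isCompact_closedBall (0 : ι → ℝ) 1) fun x hx => hsupp x ?_
  simpa using hx

/-- After dilation by N, replacing the function on a unit cell by its value at the corner costs at
most L/N pointwise, and only inside a cube of volume (4N)^card. -/
theorem norm_riemannSum_sub_integral_le {G : (ι → ℝ) → ℂ} (hG : Continuous G) {L : ℝ} (hL0 : 0 ≤ L)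
    (hL : ∀ x y, ‖x - y‖ ≤ 1 → ‖G x - G y‖ ≤ L * ‖x - y‖) (hsupp : ∀ x, 1 < ‖x‖ → G x = 0)
    {N : ℕ} (hN : 1 ≤ N) :
    ‖((N : ℂ) ^ Fintype.card ι)⁻¹ * (∑' u : ι → ℤ, G fun i => (u i : ℝ) / N) - ∫ x, G x‖ ≤
      L * 4 ^ Fintype.card ι / N := by
  have hN0 : (0 : ℝ) < N := by exact_mod_cast hN
  have hN1 : (1 : ℝ) ≤ N := by exact_mod_cast hN
  set H : (ι → ℝ) → ℂ := fun y => G ((N : ℝ)⁻¹ • y) with hH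
  have hHcont : Continuous H := by fun_prop
  have hGint : Integrable G := hG.integrable_of_hasCompactSupport (hasCompactSupport_of_eq_zero hsupp)
  have hHint : Integrable H := by
    rw [hH]
    exact (integrable_comp_smul_iff volume G (inv_ne_zero hN0.ne')).mpr hGint
  have hHG : ∫ x, G x = ((N : ℂ) ^ Fintype.card ι)⁻¹ * ∫ y, H y := by
    rw [hH, Measure.integral_comp_smul]
    simp only [Module.finrank_fintype_fun_eq_card, inv_pow, inv_inv]
    rw [abs_of_pos (by positivity), Complex.real_smul, ← mul_assoc]
    push_cast
    rw [inv_mul_cancel₀ (pow_ne_zero _ (Nat.cast_ne_zero.mpr (by omega))), one_mul]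
  have hpt : ∀ u : ι → ℤ, (fun i => (u i : ℝ) / N) = (N : ℝ)⁻¹ • fun i => (u i : ℝ) := by
    intro u
    ext i
    simp [div_eq_inv_mul]
  -- H vanishes beyond radius N. A cell containing a point beyond 2N has its corner beyond 2N - 1 ≥
  -- N, so both values vanish there.
  set S : Set (ι → ℝ) := Metric.closedBall 0 (2 * N) with hS
  have hbd : ∀ (u : ι → ℤ), ∀ y ∈ unitCell u,
      ‖H (fun i => (u i : ℝ)) - H y‖ ≤ S.indicator (fun _ => L / N) y := by
    intro u y hy
    have h1 := norm_sub_le_one_of_mem_unitCell hy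
    rw [norm_sub_rev] at h1
    by_cases hyS : y ∈ S
    · rw [Set.indicator_of_mem hyS]
      have h2 : ‖(N : ℝ)⁻¹ • (fun i => (u i : ℝ)) - (N : ℝ)⁻¹ • y‖ ≤ (N : ℝ)⁻¹ := by
        rw [← smul_sub, norm_smul, norm_inv, Real.norm_natCast]
        exact mul_le_of_le_one_right (by positivity) h1
      refine (hL _ _ (h2.trans (inv_le_one_of_one_le₀ hN1))).trans ?_
      rw [div_eq_mul_inv]
      exact mul_le_mul_of_nonneg_left h2 hL0
    · rw [Set.indicator_of_notMem hyS]
      have h3 : 2 * (N : ℝ) < ‖y‖ := by simpa [hS] using hyS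
      have h4 : (N : ℝ) < ‖fun i => (u i : ℝ)‖ := by
        have := norm_le_norm_add_norm_sub (fun i => (u i : ℝ)) y
        linarith
      have h5 : ∀ z : ι → ℝ, (N : ℝ) < ‖z‖ → H z = 0 := by
        intro z hz
        refine hsupp _ ?_
        rw [norm_smul, norm_inv, Real.norm_natCast, lt_inv_mul_iff₀ hN0, mul_one]
        exact hz
      rw [h5 _ h4, h5 y (by linarith), sub_zero, norm_zero]
  have hSint : Integrable (S.indicator fun _ => L / N) := by
    refine (integrable_indicator_iff measurableSet_closedBall).mpr ?_
    exact integrableOn_const measure_closedBall_lt_top.ne enorm_ne_top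
  have hsum1 := hasSum_setIntegral_unitCell hSint
  have hsum2 := hasSum_setIntegral_unitCell hHint
  have hterm : ∀ u : ι → ℤ, H (fun i => (u i : ℝ)) - ∫ y in unitCell u, H y =
      ∫ y in unitCell u, (H (fun i => (u i : ℝ)) - H y) := by
    intro u
    have hconst : IntegrableOn (fun _ => H fun i => (u i : ℝ)) (unitCell u) :=
      integrableOn_const (by simp [volume_unitCell]) enorm_ne_top
    rw [integral_sub hconst hHint.integrableOn, setIntegral_const, measureReal_def, volume_unitCell]
    simp
  have hle : ∀ u : ι → ℤ, ‖H (fun i => (u i : ℝ)) - ∫ y in unitCell u, H y‖ ≤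
      ∫ y in unitCell u, S.indicator (fun _ => L / N) y := by
    intro u
    rw [hterm]
    exact norm_integral_le_of_norm_le hSint.integrableOn
      ((ae_restrict_iff' (measurableSet_unitCell u)).mpr (Filter.Eventually.of_forall (hbd u)))
  have hdiff : Summable fun u : ι → ℤ => H (fun i => (u i : ℝ)) - ∫ y in unitCell u, H y :=
    Summable.of_norm_bounded hsum1.summable hle
  have hHsum : Summable fun u : ι → ℤ => H fun i => (u i : ℝ) := by
    simpa using hdiff.add hsum2.summable
  have key : ‖(∑' u : ι → ℤ, H fun i => (u i : ℝ)) - ∫ y, H y‖ ≤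
      ∫ y, S.indicator (fun _ => L / N) y := by
    rw [← hsum2.tsum_eq, ← hHsum.tsum_sub hsum2.summable]
    exact tsum_of_norm_bounded hsum1 hle
  have hvol : ∫ y, S.indicator (fun _ => L / N) y = (4 * N) ^ Fintype.card ι * (L / N) := by
    rw [integral_indicator measurableSet_closedBall, setIntegral_const, measureReal_def,
      Real.volume_pi_closedBall _ (by positivity), ENNReal.toReal_ofReal (by positivity), smul_eq_mul]
    ring
  simp only [hpt]
  rw [hHG, ← mul_sub, norm_mul, norm_inv, norm_pow, Complex.norm_natCast,
    inv_mul_le_iff₀ (by positivity)]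
  refine (key.trans_eq hvol).trans_eq ?_
  rw [mul_pow]
  ring

end Riemann

/-! ### Vectors supported on a pairing -/

section PairLift

variable {n : ℕ} {σ : Finset (Fin n × Fin n)} {R : Type*} [CommRing R]

/-- The vector with value `l p` at `p.1` and `-l p` at `p.2`, for every pair `p`. -/
def pairLift (l : σ → R) (i : Fin n) : R :=
  ∑ p : σ, ((if i = p.1.1 then l p else 0) - if i = p.1.2 then l p else 0)

theorem pairLift_eq_sum_basisDiff (ξ : σ → ℝ) :
    ∑ p : σ, ξ p • basisDiff p.1.1 p.1.2 = pairLift ξ := by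
  ext i
  rw [Finset.sum_apply, pairLift]
  refine Finset.sum_congr rfl fun p _ => ?_
  simp [basisDiff, Pi.single_apply, mul_sub]

theorem sum_pairLift (l : σ → R) : ∑ i, pairLift l i = 0 := by
  simp only [pairLift]
  rw [Finset.sum_comm]
  refine Finset.sum_eq_zero fun p _ => ?_
  rw [Finset.sum_sub_distrib]
  simp

theorem pairLift_fst (hσ : IsPairing σ) (l : σ → R) (p : σ) : pairLift l p.1.1 = l p := by
  rw [pairLift, Finset.sum_eq_single p]
  · rw [if_pos rfl, if_neg (hσ.1 _ p.2).ne, sub_zero]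
  · intro q _ hq
    rw [if_neg fun h => hq (Subtype.ext (hσ.eq_of_mem q.2 p.2 (Or.inl h) (Or.inl rfl))),
      if_neg fun h => hq (Subtype.ext (hσ.eq_of_mem q.2 p.2 (Or.inr h) (Or.inl rfl))), sub_zero]
  · simp

theorem pairLift_snd (hσ : IsPairing σ) (l : σ → R) (p : σ) : pairLift l p.1.2 = -l p := by
  rw [pairLift, Finset.sum_eq_single p]
  · rw [if_pos rfl, if_neg (hσ.1 _ p.2).ne', zero_sub]
  · intro q _ hq
    rw [if_neg fun h => hq (Subtype.ext (hσ.eq_of_mem q.2 p.2 (Or.inl h) (Or.inr rfl))),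
      if_neg fun h => hq (Subtype.ext (hσ.eq_of_mem q.2 p.2 (Or.inr h) (Or.inr rfl))), sub_zero]
  · simp

theorem pairLift_of_notMem (l : σ → R) {i : Fin n} (hi : ¬ ∃ p ∈ σ, i = p.1 ∨ i = p.2) :
    pairLift l i = 0 := by
  refine Finset.sum_eq_zero fun p _ => ?_
  rw [if_neg fun h => hi ⟨p, p.2, Or.inl h⟩, if_neg fun h => hi ⟨p, p.2, Or.inr h⟩, sub_zero]

theorem compatible_pairLift (hσ : IsPairing σ) {l : σ → ℤ} (hl : ∀ p, l p ≠ 0) :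
    Compatible σ (pairLift l) := by
  constructor
  · intro p hp
    have h1 := pairLift_fst hσ l ⟨p, hp⟩
    have h2 := pairLift_snd hσ l ⟨p, hp⟩
    simp only at h1 h2
    rw [h1, h2, add_neg_cancel]
  · intro i
    constructor
    · intro hi
      by_contra hne
      exact hi (pairLift_of_notMem l hne)
    · rintro ⟨p, hp, rfl | rfl⟩
      · exact (pairLift_fst hσ l ⟨p, hp⟩).trans_ne (hl _)
      · exact (pairLift_snd hσ l ⟨p, hp⟩).trans_ne (neg_ne_zero.mpr (hl _))

/-- With `compatible_pairLift`, this parametrizes the vectors compatible with σ by one nonzero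
integer per pair. -/
theorem Compatible.eq_pairLift (hσ : IsPairing σ) {k : Fin n → ℤ} (hk : Compatible σ k) :
    k = pairLift fun p : σ => k p.1.1 := by
  ext i
  by_cases hi : ∃ p ∈ σ, i = p.1 ∨ i = p.2
  · obtain ⟨p, hp, rfl | rfl⟩ := hi
    · exact (pairLift_fst hσ (fun p : σ => k p.1.1) ⟨p, hp⟩).symm
    · have h1 := hk.1 p hp
      have h2 := pairLift_snd hσ (fun p : σ => k p.1.1) ⟨p, hp⟩
      simp only at h2
      rw [h2]
      omega
  · rw [pairLift_of_notMem _ hi]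
    by_contra hne
    exact hi ((hk.2 i).mp hne)

theorem Compatible.two_mul_card_le (hσ : IsPairing σ) {k : Fin n → ℤ} (hk : Compatible σ k) :
    2 * σ.card ≤ n := by
  have h1 := Fintype.card_of_bijective (bijective_pairPos hσ hk)
  have h2 := Fintype.card_of_bijective (bijective_pairNeg hσ hk)
  rw [Fintype.card_coe, Fintype.card_subtype] at h1 h2
  have h3 := Finset.card_union_of_disjoint (s := Finset.univ.filter fun i => 0 < k i)
    (t := Finset.univ.filter fun i => k i < 0)
    (Finset.disjoint_filter.mpr fun i _ h => h.not_gt)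
  have h4 := Finset.card_le_univ
    ((Finset.univ.filter fun i => 0 < k i) ∪ Finset.univ.filter fun i => k i < 0)
  rw [Fintype.card_fin] at h4
  omega

theorem IsPairing.two_mul_card_le (hσ : IsPairing σ) : 2 * σ.card ≤ n :=
  (compatible_pairLift hσ (l := fun _ => 1) fun _ => one_ne_zero).two_mul_card_le hσ

theorem norm_pairLift_le (ξ : σ → ℝ) :
    ‖pairLift ξ‖ ≤ (∑ p : σ, ‖basisDiff p.1.1 p.1.2‖) * ‖ξ‖ := by
  rw [← pairLift_eq_sum_basisDiff, Finset.sum_mul]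
  refine (norm_sum_le _ _).trans (Finset.sum_le_sum fun p _ => ?_)
  rw [norm_smul, mul_comm]
  exact mul_le_mul_of_nonneg_left (norm_le_pi_norm ξ p) (norm_nonneg _)

theorem pairLift_sub (ξ ζ : σ → R) : pairLift (ξ - ζ) = pairLift ξ - pairLift ζ := by
  ext i
  rw [Pi.sub_apply, pairLift, pairLift, pairLift, ← Finset.sum_sub_distrib]
  refine Finset.sum_congr rfl fun p _ => ?_
  rw [Pi.sub_apply]
  split_ifs <;> ring

@[fun_prop]
theorem continuous_pairLift : Continuous (pairLift : (σ → ℝ) → Fin n → ℝ) := by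
  simp only [← funext pairLift_eq_sum_basisDiff]
  fun_prop

end PairLift

/-! ### The integrands of the main term -/

section Integrand

/-- Replace one factor at a time. The bound 2 on the factors fits points within distance 1 of the
unit ball. -/
theorem abs_prod_sub_prod_le {κ : Type*} (s : Finset κ) (a b : κ → ℝ) {δ : ℝ}
    (ha : ∀ i ∈ s, 0 ≤ a i ∧ a i ≤ 2) (hb : ∀ i ∈ s, 0 ≤ b i ∧ b i ≤ 2) (hδ : 0 ≤ δ)
    (hab : ∀ i ∈ s, |a i - b i| ≤ δ) :
    |∏ i ∈ s, a i - ∏ i ∈ s, b i| ≤ s.card * 2 ^ s.card * δ := by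
  classical
  induction s using Finset.induction_on with
  | empty => simp
  | insert j s hj ih =>
    rw [Finset.prod_insert hj, Finset.prod_insert hj, Finset.card_insert_of_notMem hj]
    have h1 := ih (fun i hi => ha i (Finset.mem_insert_of_mem hi))
      (fun i hi => hb i (Finset.mem_insert_of_mem hi))
      (fun i hi => hab i (Finset.mem_insert_of_mem hi))
    have hA0 : 0 ≤ ∏ i ∈ s, a i :=
      Finset.prod_nonneg fun i hi => (ha i (Finset.mem_insert_of_mem hi)).1
    have hA : ∏ i ∈ s, a i ≤ 2 ^ s.card :=
      (Finset.prod_le_prod (fun i hi => (ha i (Finset.mem_insert_of_mem hi)).1)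
        fun i hi => (ha i (Finset.mem_insert_of_mem hi)).2).trans_eq (by simp)
    have haj := ha j (Finset.mem_insert_self j s)
    have hbj := hb j (Finset.mem_insert_self j s)
    have habj := hab j (Finset.mem_insert_self j s)
    calc |a j * ∏ i ∈ s, a i - b j * ∏ i ∈ s, b i|
        = |(a j - b j) * ∏ i ∈ s, a i + b j * (∏ i ∈ s, a i - ∏ i ∈ s, b i)| := by ring_nf
      _ ≤ |a j - b j| * (∏ i ∈ s, a i) + b j * |∏ i ∈ s, a i - ∏ i ∈ s, b i| := by
          refine (abs_add_le _ _).trans_eq ?_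
          rw [abs_mul, abs_mul, abs_of_nonneg hA0, abs_of_nonneg hbj.1]
      _ ≤ δ * 2 ^ s.card + 2 * (s.card * 2 ^ s.card * δ) := by
          gcongr
          exact hbj.2
      _ ≤ ((s.card + 1 : ℕ) : ℝ) * 2 ^ (s.card + 1) * δ := by
          push_cast
          rw [pow_succ]
          nlinarith [mul_nonneg hδ (pow_nonneg zero_le_two s.card : (0 : ℝ) ≤ 2 ^ s.card)]

theorem exists_lipschitz_schwartz {E F : Type*} [NormedAddCommGroup E] [NormedSpace ℝ E]
    [NormedAddCommGroup F] [NormedSpace ℝ F] (f : SchwartzMap E F) :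
    ∃ K, 0 ≤ K ∧ ∀ x y, ‖f x - f y‖ ≤ K * ‖x - y‖ := by
  obtain ⟨K, hK0, hK⟩ := f.decay 0 1
  refine ⟨K, hK0.le, fun x y => ?_⟩
  refine Convex.norm_image_sub_le_of_norm_fderiv_le (𝕜 := ℝ) (s := Set.univ)
    (fun z _ => f.differentiableAt) (fun z _ => ?_) convex_univ (Set.mem_univ y) (Set.mem_univ x)
  have := hK z
  rwa [pow_zero, one_mul, norm_iteratedFDeriv_one] at this

variable {n : ℕ} {σ : Finset (Fin n × Fin n)}

/-- The integrand of the main term attached to a set of pairs. -/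
def pairIntegrand (Φ : SchwartzMap (Fin n → ℝ) ℂ) (σ : Finset (Fin n × Fin n)) (ξ : σ → ℝ) : ℂ :=
  Φ (pairLift ξ) * ((∏ p : σ, |ξ p| : ℝ) : ℂ)

theorem continuous_pairIntegrand (Φ : SchwartzMap (Fin n → ℝ) ℂ) :
    Continuous (pairIntegrand Φ σ) := by
  have := Φ.continuous
  unfold pairIntegrand
  fun_prop

/-- Each pair contributes 2|ξ p| to the sum of absolute values, so support radius 2 confines every ξ
p to |ξ p| < 1. -/
theorem pairIntegrand_eq_zero {Φ : SchwartzMap (Fin n → ℝ) ℂ}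
    (hΦ : ∀ ξ, Φ ξ ≠ 0 → ∑ j, |ξ j| < 2) (hσ : IsPairing σ) {ξ : σ → ℝ} (hξ : 1 < ‖ξ‖) :
    pairIntegrand Φ σ ξ = 0 := by
  by_contra hne
  have h1 := hΦ _ (left_ne_zero_of_mul hne)
  refine hξ.not_ge ((pi_norm_le_iff_of_nonneg zero_le_one).mpr fun p => ?_)
  have h2 : |pairLift ξ p.1.1| + |pairLift ξ p.1.2| ≤ ∑ j, |pairLift ξ j| := by
    rw [← Finset.sum_pair (f := fun j => |pairLift ξ j|) (hσ.1 _ p.2).ne]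
    exact Finset.sum_le_sum_of_subset_of_nonneg (Finset.subset_univ _) fun _ _ _ => abs_nonneg _
  rw [pairLift_fst hσ, pairLift_snd hσ, abs_neg] at h2
  rw [Real.norm_eq_abs]
  linarith

theorem exists_lipschitz_pairIntegrand {Φ : SchwartzMap (Fin n → ℝ) ℂ}
    (hΦ : ∀ ξ, Φ ξ ≠ 0 → ∑ j, |ξ j| < 2) (hσ : IsPairing σ) :
    ∃ L, 0 ≤ L ∧ ∀ x y : σ → ℝ, ‖x - y‖ ≤ 1 →
      ‖pairIntegrand Φ σ x - pairIntegrand Φ σ y‖ ≤ L * ‖x - y‖ := by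
  obtain ⟨K, hK0, hK⟩ := exists_lipschitz_schwartz Φ
  obtain ⟨B, hB0, hB⟩ := Φ.decay 0 0
  set M := ∑ p : σ, ‖basisDiff p.1.1 p.1.2‖ with hM
  have hM0 : 0 ≤ M := Finset.sum_nonneg fun _ _ => norm_nonneg _
  set s := Fintype.card σ with hs
  refine ⟨K * M * 2 ^ s + B * (s * 2 ^ s), by positivity, fun x y hxy => ?_⟩
  -- The product of the |ξ p| need not be globally Lipschitz. If one point lies in the unit ball,
  -- both have norm at most 2; otherwise both values vanish.
  by_cases h : 1 < ‖x‖ ∧ 1 < ‖y‖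
  · rw [pairIntegrand_eq_zero hΦ hσ h.1, pairIntegrand_eq_zero hΦ hσ h.2, sub_zero, norm_zero]
    positivity
  have h1 := norm_le_norm_add_norm_sub x y
  have h2 := norm_le_norm_add_norm_sub' x y
  have hx : ‖x‖ ≤ 2 := by
    by_contra hlt
    exact h ⟨by linarith, by linarith⟩
  have hy : ‖y‖ ≤ 2 := by
    by_contra hlt
    exact h ⟨by linarith, by linarith⟩
  have hxp : ∀ p, |x p| ≤ 2 := fun p => (norm_le_pi_norm x p).trans hx
  have hyp : ∀ p, |y p| ≤ 2 := fun p => (norm_le_pi_norm y p).trans hy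
  have hprod : abs ((∏ p : σ, |x p|) - ∏ p : σ, |y p|) ≤ s * 2 ^ s * ‖x - y‖ := by
    refine abs_prod_sub_prod_le Finset.univ (fun p => |x p|) (fun p => |y p|)
      (fun p _ => ⟨abs_nonneg _, hxp p⟩) (fun p _ => ⟨abs_nonneg _, hyp p⟩) (norm_nonneg _)
      fun p _ => ?_
    exact (abs_abs_sub_abs_le_abs_sub _ _).trans (norm_le_pi_norm (x - y) p)
  have hle : ∏ p : σ, |x p| ≤ 2 ^ s :=
    (Finset.prod_le_prod (fun _ _ => abs_nonneg _) fun p _ => hxp p).trans_eq (by simp [hs])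
  have hΦ1 : ‖Φ (pairLift x) - Φ (pairLift y)‖ ≤ K * (M * ‖x - y‖) := by
    refine (hK _ _).trans (mul_le_mul_of_nonneg_left ?_ hK0)
    rw [← pairLift_sub]
    exact norm_pairLift_le _
  have hΦ2 : ‖Φ (pairLift y)‖ ≤ B := by simpa using hB (pairLift y)
  have hprod0 : 0 ≤ ∏ p : σ, |x p| := Finset.prod_nonneg fun _ _ => abs_nonneg _
  have hsplit : pairIntegrand Φ σ x - pairIntegrand Φ σ y =
      (Φ (pairLift x) - Φ (pairLift y)) * ((∏ p : σ, |x p| : ℝ) : ℂ) +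
        Φ (pairLift y) * (((∏ p : σ, |x p|) - ∏ p : σ, |y p| : ℝ) : ℂ) := by
    unfold pairIntegrand
    push_cast
    ring
  rw [hsplit]
  refine (norm_add_le _ _).trans ?_
  rw [norm_mul, norm_mul, Complex.norm_real, Complex.norm_real, Real.norm_eq_abs, Real.norm_eq_abs,
    abs_of_nonneg hprod0]
  calc _ ≤ K * (M * ‖x - y‖) * 2 ^ s + B * (s * 2 ^ s * ‖x - y‖) := by gcongr
    _ = _ := by ring

theorem exists_riemann_pairIntegrand {Φ : SchwartzMap (Fin n → ℝ) ℂ}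
    (hΦ : ∀ ξ, Φ ξ ≠ 0 → ∑ j, |ξ j| < 2) (hσ : IsPairing σ) :
    ∃ C, ∀ N : ℕ, 1 ≤ N →
      ‖((N : ℂ) ^ σ.card)⁻¹ * (∑' u : σ → ℤ, pairIntegrand Φ σ fun p => (u p : ℝ) / N) -
        ∫ ξ, pairIntegrand Φ σ ξ‖ ≤ C / N := by
  obtain ⟨L, hL0, hL⟩ := exists_lipschitz_pairIntegrand hΦ hσ
  refine ⟨L * 4 ^ Fintype.card σ, fun N hN => ?_⟩
  have := norm_riemannSum_sub_integral_le (continuous_pairIntegrand Φ) hL0 hL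
    (fun ξ => pairIntegrand_eq_zero hΦ hσ) hN
  rwa [Fintype.card_coe] at this ⊢

end Integrand

/-! ### The hyperplane of vectors with zero sum -/

section ZeroSum

variable {R : Type*} [AddCommGroup R] {d : ℕ}

/-- Extension of a vector by a last coordinate which makes the sum vanish. -/
def zeroSumExt (η : Fin d → R) : Fin (d + 1) → R := Fin.snoc (α := fun _ => R) η (-∑ j, η j)

@[simp]
theorem zeroSumExt_castSucc (η : Fin d → R) (j : Fin d) : zeroSumExt η j.castSucc = η j :=
  Fin.snoc_castSucc (α := fun _ => R) _ _ _

@[simp]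
theorem zeroSumExt_last (η : Fin d → R) : zeroSumExt η (Fin.last d) = -∑ j, η j :=
  Fin.snoc_last (α := fun _ => R) _ _

theorem sum_zeroSumExt (η : Fin d → R) : ∑ i, zeroSumExt η i = 0 := by
  rw [Fin.sum_univ_castSucc]
  simp

theorem zeroSumExt_of_sum_eq_zero {k : Fin (d + 1) → R} (hk : ∑ i, k i = 0) :
    zeroSumExt (fun j => k j.castSucc) = k := by
  ext i
  refine Fin.lastCases ?_ (fun j => ?_) i
  · rw [Fin.sum_univ_castSucc] at hk
    rw [zeroSumExt_last]
    exact neg_eq_of_add_eq_zero_right hk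
  · simp

theorem sum_zeroSumExt_mul {R : Type*} [CommRing R] (η : Fin d → R) (x : Fin (d + 1) → R) :
    ∑ i, zeroSumExt η i * x i = ∑ j, η j * (x j.castSucc - x (Fin.last d)) := by
  rw [Fin.sum_univ_castSucc]
  simp only [zeroSumExt_castSucc, zeroSumExt_last, mul_sub, Finset.sum_sub_distrib,
    ← Finset.sum_mul]
  ring

theorem zeroSumExt_intCast_div (k : Fin d → ℤ) (c : ℝ) :
    zeroSumExt (fun j => (k j : ℝ) / c) = fun i => ((zeroSumExt k i : ℤ) : ℝ) / c := by
  ext i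
  refine Fin.lastCases ?_ (fun j => ?_) i
  · simp [neg_div, Finset.sum_div]
  · simp

/-- `zeroSumExt` as a continuous linear map on Euclidean space. -/
def zeroSumCLM (d : ℕ) : EuclideanSpace ℝ (Fin d) →L[ℝ] (Fin (d + 1) → ℝ) :=
  LinearMap.toContinuousLinearMap
    { toFun := fun η => zeroSumExt fun j => η j
      map_add' := fun η ζ => by
        ext i
        refine Fin.lastCases ?_ (fun j => ?_) i
        · simp [Finset.sum_add_distrib, add_comm]
        · simp
      map_smul' := fun c η => by
        ext i
        refine Fin.lastCases ?_ (fun j => ?_) i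
        · simp [Finset.mul_sum]
        · simp }

theorem zeroSumCLM_apply (η : EuclideanSpace ℝ (Fin d)) :
    zeroSumCLM d η = zeroSumExt fun j => η j := rfl

/-- An injective linear map in finite dimension is bounded below; composition with it therefore
preserves Schwartz decay. -/
theorem exists_norm_le_zeroSumCLM (d : ℕ) :
    ∃ (k : ℕ) (C : ℝ), ∀ η, ‖η‖ ≤ C * (1 + ‖zeroSumCLM d η‖) ^ k := by
  obtain ⟨K, -, hK⟩ := (zeroSumCLM d).toLinearMap.exists_antilipschitzWith
    (LinearMap.ker_eq_bot'.mpr fun η hη => by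
      ext j
      have := congrFun hη j.castSucc
      simpa [zeroSumCLM_apply] using this)
  refine ⟨1, K, fun η => ?_⟩
  have h := hK.le_mul_dist η 0
  rw [dist_zero_right, map_zero, dist_zero_right, ContinuousLinearMap.coe_coe] at h
  rw [pow_one]
  refine h.trans (mul_le_mul_of_nonneg_left (by linarith) K.2)

/-- The restriction of a Schwartz function to the hyperplane of vectors with zero sum. -/
def hyperplaneRestrict (Φ : SchwartzMap (Fin (d + 1) → ℝ) ℂ) :
    SchwartzMap (EuclideanSpace ℝ (Fin d)) ℂ :=
  SchwartzMap.compCLM ℝ (zeroSumCLM d).hasTemperateGrowth (exists_norm_le_zeroSumCLM d) Φ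

theorem hyperplaneRestrict_apply (Φ : SchwartzMap (Fin (d + 1) → ℝ) ℂ)
    (η : EuclideanSpace ℝ (Fin d)) : hyperplaneRestrict Φ η = Φ (zeroSumExt fun j => η j) := rfl

end ZeroSum

/-! ### The periodic test function as a Fourier series -/

section FourierSide

open scoped FourierTransform

variable {d : ℕ} {φ : (Fin (d + 1) → ℝ) → ℂ} {Φ : SchwartzMap (Fin (d + 1) → ℝ) ℂ}

theorem integral_euclidean_eq (f : EuclideanSpace ℝ (Fin d) → ℂ) :
    ∫ v, f v = ∫ y : Fin d → ℝ, f (WithLp.toLp 2 y) :=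
  ((PiLp.volume_preserving_toLp (Fin d)).integral_comp
    (MeasurableEquiv.toLp 2 (Fin d → ℝ)).measurableEmbedding f).symm

theorem fourierInv_toLp (f : EuclideanSpace ℝ (Fin d) → ℂ) (y : Fin d → ℝ) :
    𝓕⁻ f (WithLp.toLp 2 y) = ∫ η : Fin d → ℝ, waveExp η y * f (WithLp.toLp 2 η) := by
  rw [Real.fourierInv_eq', integral_euclidean_eq]
  refine integral_congr_ae (Filter.Eventually.of_forall fun η => ?_)
  simp only [smul_eq_mul, waveExp, PiLp.inner_apply, RCLike.inner_apply, conj_trivial]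
  congr 2
  push_cast
  simp only [mul_comm]
  ring

theorem fourier_toLp (f : EuclideanSpace ℝ (Fin d) → ℂ) (η : Fin d → ℝ) :
    𝓕 f (WithLp.toLp 2 η) = ∫ y : Fin d → ℝ, waveExp (-η) y * f (WithLp.toLp 2 y) := by
  rw [Real.fourier_eq', integral_euclidean_eq]
  refine integral_congr_ae (Filter.Eventually.of_forall fun y => ?_)
  simp only [smul_eq_mul, waveExp, PiLp.inner_apply, RCLike.inner_apply, conj_trivial,
    Pi.neg_apply, neg_mul, Finset.sum_neg_distrib]
  congr 2
  push_cast
  simp only [mul_comm]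
  ring

/-- On vectors of zero sum the phase depends only on the differences with the last coordinate of x.
-/
theorem eq_fourierInv_hyperplaneRestrict (h : IsRestrictedTransform φ Φ) (x : Fin (d + 1) → ℝ) :
    φ x = 𝓕⁻ (hyperplaneRestrict Φ)
      (WithLp.toLp 2 fun j => x j.castSucc - x (Fin.last d)) := by
  rw [SchwartzMap.fourierInv_coe, fourierInv_toLp, h.eq_integral, deltaIntegral]
  refine integral_congr_ae (Filter.Eventually.of_forall fun η => ?_)
  simp only [hyperplaneRestrict_apply, waveExp]
  rw [← sum_zeroSumExt_mul η x, mul_comm]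
  rfl

/-- Fourier inversion: φ determines Φ on the hyperplane, though not off it. Points x with last
coordinate 0 already reach every frequency-dual vector v. -/
theorem hyperplaneRestrict_unique {Φ' : SchwartzMap (Fin (d + 1) → ℝ) ℂ}
    (h : IsRestrictedTransform φ Φ) (h' : IsRestrictedTransform φ Φ') :
    hyperplaneRestrict Φ = hyperplaneRestrict Φ' := by
  have heq : 𝓕⁻ (hyperplaneRestrict Φ) = 𝓕⁻ (hyperplaneRestrict Φ') := by
    ext v
    have h1 := eq_fourierInv_hyperplaneRestrict h (Fin.snoc (α := fun _ => ℝ) (fun j => v j) 0)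
    have h2 := eq_fourierInv_hyperplaneRestrict h' (Fin.snoc (α := fun _ => ℝ) (fun j => v j) 0)
    rw [h1] at h2
    simpa using h2
  have := congrArg (fun f : SchwartzMap (EuclideanSpace ℝ (Fin d)) ℂ => 𝓕 f) heq
  simpa only [FourierTransform.fourier_fourierInv_eq] using this

theorem apply_eq_of_sum_eq_zero {Φ' : SchwartzMap (Fin (d + 1) → ℝ) ℂ}
    (h : IsRestrictedTransform φ Φ) (h' : IsRestrictedTransform φ Φ') {ξ : Fin (d + 1) → ℝ}
    (hξ : ∑ i, ξ i = 0) : Φ ξ = Φ' ξ := by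
  have := congrArg (fun f => f (WithLp.toLp 2 fun j => ξ j.castSucc))
    (hyperplaneRestrict_unique h h')
  simp only [hyperplaneRestrict_apply] at this
  rwa [zeroSumExt_of_sum_eq_zero hξ] at this

/-- A finite set of frequencies containing the support of `k ↦ Φ(k / N)`. -/
def freqs (d N : ℕ) : Finset (Fin d → ℤ) :=
  Fintype.piFinset fun _ => Finset.Icc (-(2 * N : ℤ)) (2 * N)

theorem sum_abs_lt_of_ne_zero (h : IsRestrictedTransform φ Φ) {N : ℕ} (hN : 1 ≤ N)
    {k : Fin (d + 1) → ℤ} (hk : Φ (fun i => (k i : ℝ) / N) ≠ 0) : ∑ i, |k i| < 2 * N := by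
  have h1 := h.support _ hk
  have hN0 : (0 : ℝ) < N := by exact_mod_cast hN
  simp only [abs_div, Nat.abs_cast] at h1
  rw [← Finset.sum_div, div_lt_iff₀ hN0] at h1
  exact_mod_cast h1

theorem mem_freqs_of_ne_zero (h : IsRestrictedTransform φ Φ) {N : ℕ} (hN : 1 ≤ N) {k : Fin d → ℤ}
    (hk : Φ (fun i => ((zeroSumExt k i : ℤ) : ℝ) / N) ≠ 0) : k ∈ freqs d N := by
  refine Fintype.mem_piFinset.mpr fun j => Finset.mem_Icc.mpr ?_
  have h1 := sum_abs_lt_of_ne_zero h hN hk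
  have h2 := Finset.single_le_sum (f := fun i => |zeroSumExt k i|) (fun i _ => abs_nonneg _)
    (Finset.mem_univ j.castSucc)
  simp only [zeroSumExt_castSucc] at h2
  exact abs_le.mp (h2.trans h1.le)

/-- The substitution z = N y gives the Jacobian N^{-d} and moves the frequency to k/N, where Fourier
inversion returns Φ. -/
theorem integral_waveExp_mul_dilate (Φ : SchwartzMap (Fin (d + 1) → ℝ) ℂ) {N : ℕ} (hN : 1 ≤ N)
    (k : Fin d → ℤ) :
    ∫ y : Fin d → ℝ, waveExp (fun i => -(k i : ℝ)) y *
        𝓕⁻ (hyperplaneRestrict Φ) (WithLp.toLp 2 ((N : ℝ) • y)) =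
      ((N : ℂ) ^ d)⁻¹ * Φ (fun i => ((zeroSumExt k i : ℤ) : ℝ) / N) := by
  have hN0 : (N : ℝ) ≠ 0 := by exact_mod_cast (by omega : N ≠ 0)
  have h1 : ∀ y : Fin d → ℝ, waveExp (fun i => -(k i : ℝ)) y =
      waveExp (-fun i => (k i : ℝ) / N) ((N : ℝ) • y) := by
    intro y
    unfold waveExp
    congr 3
    refine Finset.sum_congr rfl fun i _ => ?_
    simp only [Pi.neg_apply, Pi.smul_apply, smul_eq_mul]
    field_simp
  simp only [h1]
  rw [Measure.integral_comp_smul volume (fun z : Fin d → ℝ =>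
    waveExp (-fun i => (k i : ℝ) / N) z * 𝓕⁻ (hyperplaneRestrict Φ) (WithLp.toLp 2 z)),
    ← fourier_toLp, ← SchwartzMap.fourier_coe, FourierTransform.fourier_fourierInv_eq,
    hyperplaneRestrict_apply]
  simp only
  rw [zeroSumExt_intCast_div, Module.finrank_fin_fun, abs_of_nonneg (by positivity),
    Complex.real_smul]
  push_cast
  rfl

theorem exists_decay_dilate (f : SchwartzMap (EuclideanSpace ℝ (Fin d)) ℂ) {N : ℕ} (hN : 1 ≤ N)
    (p : ℕ) : ∃ C, ∀ y : Fin d → ℝ, (1 + ‖y‖) ^ p * ‖f (WithLp.toLp 2 ((N : ℝ) • y))‖ ≤ C := by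
  have h1 := SchwartzMap.one_add_le_sup_seminorm_apply (𝕜 := ℝ) (m := (p, 0)) (k := p) (n := 0)
    le_rfl le_rfl f
  simp only [norm_iteratedFDeriv_zero] at h1
  refine ⟨_, fun y => le_trans ?_ (h1 (WithLp.toLp 2 ((N : ℝ) • y)))⟩
  gcongr
  refine (pi_norm_le_iff_of_nonneg (norm_nonneg _)).mpr fun i => ?_
  refine le_trans ?_ (PiLp.norm_apply_le (WithLp.toLp 2 ((N : ℝ) • y) : EuclideanSpace ℝ (Fin d)) i)
  simp only [Pi.smul_apply, smul_eq_mul, norm_mul, Real.norm_natCast]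
  exact le_mul_of_one_le_left (norm_nonneg _) (by exact_mod_cast hN)

/-- The periodic test function is a trigonometric polynomial. -/
theorem periodized_eq_sum (h : IsRestrictedTransform φ Φ) {N : ℕ} (hN : 1 ≤ N)
    (x : Fin (d + 1) → ℝ) :
    periodized N φ x = ((N : ℂ) ^ d)⁻¹ * ∑ k ∈ freqs d N,
      Φ (fun i => ((zeroSumExt k i : ℤ) : ℝ) / N) * waveExp (fun i => ((zeroSumExt k i : ℤ) : ℝ)) x := by
  set g : (Fin d → ℝ) → ℂ := fun y =>
    𝓕⁻ (hyperplaneRestrict Φ) (WithLp.toLp 2 ((N : ℝ) • y)) with hg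
  have hgcont : Continuous g := by
    have := (𝓕⁻ (hyperplaneRestrict Φ)).continuous
    fun_prop
  obtain ⟨C, hC⟩ := exists_decay_dilate (𝓕⁻ (hyperplaneRestrict Φ)) hN (d + 1)
  -- Only finitely many coefficients survive, so the summability needed for Poisson summation is
  -- automatic.
  have hzero : ∀ k ∉ freqs d N, ∫ y, waveExp (fun i => -(k i : ℝ)) y * g y = 0 := by
    intro k hk
    rw [hg, integral_waveExp_mul_dilate Φ hN]
    by_contra hne
    exact hk (mem_freqs_of_ne_zero h hN (right_ne_zero_of_mul hne))
  have hP := hasSum_poisson hgcont (p := d + 1) (by simp) hC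
    (summable_of_ne_finset_zero hzero) fun j => x j.castSucc - x (Fin.last d)
  have h1 : periodized N φ x = ∑' u : Fin d → ℤ,
      g ((fun j => x j.castSucc - x (Fin.last d)) + fun i => (u i : ℝ)) := by
    refine tsum_congr fun u => ?_
    rw [eq_fourierInv_hyperplaneRestrict h, hg]
    congr 2
    ext j
    simp
    ring
  rw [h1, ← hP.tsum_eq, tsum_eq_sum fun k hk => by rw [hzero k hk, zero_mul], Finset.mul_sum]
  refine Finset.sum_congr rfl fun k _ => ?_
  rw [hg, integral_waveExp_mul_dilate Φ hN, mul_assoc]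
  congr 2
  unfold waveExp
  have h2 := sum_zeroSumExt_mul (fun j => (k j : ℝ)) x
  have h3 := zeroSumExt_intCast_div k 1
  simp only [div_one] at h3
  rw [h3] at h2
  rw [h2]

end FourierSide

/-! ### The mean of the correlation -/

section Mean

variable {d N : ℕ} {φ : (Fin (d + 1) → ℝ) → ℂ} {Φ : SchwartzMap (Fin (d + 1) → ℝ) ℂ}

theorem sum_waveExp_eigenangles (U : Matrix.unitaryGroup (Fin N) ℂ) {θ : Fin N → ℝ}
    (hθ : IsEigenangles (U : Matrix (Fin N) (Fin N) ℂ) θ) {n : ℕ} (k : Fin n → ℤ) :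
    ∑ j : Fin n → Fin N, waveExp (fun i => (k i : ℝ)) (fun i => θ (j i)) =
      ∏ i, tracePow U (k i) := by
  simp only [tracePow_eq_sum_exp U hθ]
  rw [Finset.prod_univ_sum, Fintype.piFinset_univ]
  refine Finset.sum_congr rfl fun j _ => ?_
  rw [← Complex.exp_sum, waveExp]
  congr 1
  push_cast
  rw [Finset.mul_sum]

/-- The sum of a character over all index tuples factors into traces. This trigonometric form also
shows that the correlation is continuous in U, although the chosen eigenangles need not be. -/
theorem correlation_eq_sum (h : IsRestrictedTransform φ Φ) (hN : 1 ≤ N)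
    (U : Matrix.unitaryGroup (Fin N) ℂ) :
    correlation U φ = ((N : ℂ) ^ (d + 1))⁻¹ * ∑ k ∈ freqs d N,
      Φ (fun i => ((zeroSumExt k i : ℤ) : ℝ) / N) * ∏ i, tracePow U (zeroSumExt k i) := by
  have hθ : IsEigenangles (U : Matrix (Fin N) (Fin N) ℂ) (eigenangles U) :=
    (exists_isEigenangles U).choose_spec
  unfold correlation angleCorrelation
  simp only [periodized_eq_sum h hN]
  rw [← Finset.mul_sum, Finset.sum_comm, ← mul_assoc]
  congr 1
  · rw [pow_succ, mul_inv, one_div, mul_comm]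
  · refine Finset.sum_congr rfl fun k _ => ?_
    rw [← Finset.mul_sum, sum_waveExp_eigenangles U hθ]

theorem integrable_correlation (h : IsRestrictedTransform φ Φ) (hN : 1 ≤ N) :
    Integrable (fun U : Matrix.unitaryGroup (Fin N) ℂ => correlation U φ) (haarUnitary N) := by
  simp only [correlation_eq_sum h hN]
  exact integrable_haarUnitary (by fun_prop)

/-- Compatible vectors correspond to l with no zero entry; the remaining l may be included because
their weight vanishes. -/
theorem tsum_compatible_eq (F : (Fin (d + 1) → ℤ) → ℂ)
    {σ : Finset (Fin (d + 1) × Fin (d + 1))} (hσ : IsPairing σ) [DecidablePred (Compatible σ)] :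
    ∑' k : Fin d → ℤ, (if Compatible σ (zeroSumExt k) then
      F (zeroSumExt k) * ∏ p ∈ σ, ((zeroSumExt k p.1).natAbs : ℂ) else 0) =
    ∑' l : σ → ℤ, F (pairLift l) * ∏ p : σ, ((l p).natAbs : ℂ) := by
  refine tsum_eq_tsum_of_ne_zero_bij (fun l j => pairLift l.1 j.castSucc) ?_ ?_ ?_
  · intro l l' hll
    have h1 : pairLift l.1 = pairLift l'.1 := by
      rw [← zeroSumExt_of_sum_eq_zero (sum_pairLift l.1),
        ← zeroSumExt_of_sum_eq_zero (sum_pairLift l'.1)]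
      exact congrArg zeroSumExt hll
    refine Subtype.ext (funext fun p => ?_)
    rw [← pairLift_fst hσ l.1, h1, pairLift_fst hσ]
  · intro k hk
    rw [Function.mem_support] at hk
    have hc : Compatible σ (zeroSumExt k) := by
      by_contra hne
      exact hk (if_neg hne)
    rw [if_pos hc] at hk
    have hlift := hc.eq_pairLift hσ
    refine ⟨⟨fun p => zeroSumExt k p.1.1, ?_⟩, ?_⟩
    · rw [Function.mem_support, ← hlift]
      rwa [← Finset.prod_coe_sort] at hk
    · ext j
      simp only
      rw [← hlift, zeroSumExt_castSucc]
  · rintro ⟨l, hl⟩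
    have hl0 : ∀ p, l p ≠ 0 := by
      intro p hp
      rw [Function.mem_support] at hl
      refine hl (mul_eq_zero_of_right _ (Finset.prod_eq_zero (Finset.mem_univ p) ?_))
      simp [hp]
    simp only
    rw [zeroSumExt_of_sum_eq_zero (sum_pairLift l), if_pos (compatible_pairLift hσ hl0),
      ← Finset.prod_coe_sort]
    refine congrArg _ (Finset.prod_congr rfl fun p _ => ?_)
    rw [pairLift_fst hσ]

theorem pairIntegrand_div (Φ : SchwartzMap (Fin (d + 1) → ℝ) ℂ) (N : ℕ)
    {σ : Finset (Fin (d + 1) × Fin (d + 1))} (l : σ → ℤ) :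
    pairIntegrand Φ σ (fun p => (l p : ℝ) / N) = ((N : ℂ) ^ σ.card)⁻¹ *
      (Φ (fun i => ((pairLift l i : ℤ) : ℝ) / N) * ∏ p : σ, ((l p).natAbs : ℂ)) := by
  have h1 : pairLift (fun p : σ => (l p : ℝ) / N) = fun i => ((pairLift l i : ℤ) : ℝ) / N := by
    ext i
    simp only [pairLift]
    push_cast
    rw [Finset.sum_div]
    refine Finset.sum_congr rfl fun p _ => ?_
    rw [sub_div]
    split_ifs <;> simp
  have h2 : ∀ p, |(l p : ℝ) / N| = ((l p).natAbs : ℝ) * (N : ℝ)⁻¹ := by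
    intro p
    rw [abs_div, Nat.abs_cast, Nat.cast_natAbs, Int.cast_abs, div_eq_mul_inv]
  rw [pairIntegrand, h1]
  simp only [h2]
  rw [Finset.prod_mul_distrib, Finset.prod_const, Finset.card_univ, Fintype.card_coe]
  push_cast
  rw [inv_pow]
  ring

open Classical in
/-- The mean of the correlation is a sum of Riemann sums. -/
theorem integral_correlation (h : IsRestrictedTransform φ Φ) (hN : 1 ≤ N) :
    ∫ U : Matrix.unitaryGroup (Fin N) ℂ, correlation U φ ∂(haarUnitary N) =
      ∑ σ : Finset (Fin (d + 1) × Fin (d + 1)) with IsPairing σ,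
        ((N : ℂ) ^ σ.card)⁻¹ * ∑' l : σ → ℤ, pairIntegrand Φ σ fun p => (l p : ℝ) / N := by
  have hNC : (N : ℂ) ≠ 0 := Nat.cast_ne_zero.mpr (by omega)
  have h1 : ∀ k : Fin d → ℤ, ∫ U : Matrix.unitaryGroup (Fin N) ℂ,
      Φ (fun i => ((zeroSumExt k i : ℤ) : ℝ) / N) * ∏ i, tracePow U (zeroSumExt k i)
        ∂(haarUnitary N) =
      ∑ σ : Finset (Fin (d + 1) × Fin (d + 1)) with IsPairing σ,
        (N : ℂ) ^ (d + 1 - 2 * σ.card) * if Compatible σ (zeroSumExt k) then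
          Φ (fun i => ((zeroSumExt k i : ℤ) : ℝ) / N) *
            ∏ p ∈ σ, ((zeroSumExt k p.1).natAbs : ℂ) else 0 := by
    intro k
    rw [integral_const_mul]
    -- The moment formula is needed only where Φ(k/N) is nonzero, and there k is in the stable
    -- range.
    by_cases hk : Φ (fun i => ((zeroSumExt k i : ℤ) : ℝ) / N) = 0
    · simp [hk]
    rw [integral_prod_tracePow _ (sum_zeroSumExt k) (sum_abs_lt_of_ne_zero h hN hk).le,
      Finset.sum_filter, Finset.mul_sum]
    refine Finset.sum_congr rfl fun σ _ => ?_
    by_cases hσ : IsPairing σ <;> by_cases hc : Compatible σ (zeroSumExt k) <;> simp [hσ, hc]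
    ring
  simp only [correlation_eq_sum h hN]
  rw [integral_const_mul, integral_finsetSum _ fun k _ => integrable_haarUnitary (by fun_prop)]
  simp only [h1]
  rw [Finset.sum_comm, Finset.mul_sum]
  refine Finset.sum_congr rfl fun σ hσ => ?_
  replace hσ : IsPairing σ := (Finset.mem_filter.mp hσ).2
  rw [← Finset.mul_sum]
  have h2 := tsum_compatible_eq (fun k => Φ fun i => (k i : ℝ) / N) hσ
  rw [tsum_eq_sum (s := freqs d N)] at h2
  · rw [h2]
    simp only [pairIntegrand_div]
    rw [tsum_mul_left, ← mul_assoc, ← mul_assoc]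
    congr 1
    -- The truncated subtraction is exact. The surplus N^{-2m}, with m = `σ.card`, splits into
    -- N^{-m} for the mesh volume and N^{-m} for the weights |l p|/N.
    have h3 := hσ.two_mul_card_le
    rw [← mul_inv, ← pow_add, inv_mul_eq_iff_eq_mul₀ (pow_ne_zero _ hNC), eq_comm,
      mul_inv_eq_iff_eq_mul₀ (pow_ne_zero _ hNC), ← pow_add]
    congr 1
    omega
  · intro k hk
    have h3 : Φ (fun i => ((zeroSumExt k i : ℤ) : ℝ) / N) = 0 := by
      by_contra hne
      exact hk (mem_freqs_of_ne_zero h hN hne)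
    rw [h3, zero_mul, ite_self]

end Mean

/-! ### The main term -/

section MainTerm

variable {n : ℕ}

theorem integral_pairIntegrand_eq (Φ : SchwartzMap (Fin n → ℝ) ℂ) (σ : Finset (Fin n × Fin n)) :
    ∫ ξ, pairIntegrand Φ σ ξ = ∫ ξ : σ → ℝ, Φ (∑ p : σ, ξ p • basisDiff p.1.1 p.1.2) *
      ((∏ p : σ, |ξ p| : ℝ) : ℂ) := by
  simp only [pairLift_eq_sum_basisDiff]
  rfl

/-- ℝ^0 is a point of mass one, and the empty product is 1. -/
theorem integral_pairIntegrand_empty (Φ : SchwartzMap (Fin n → ℝ) ℂ) :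
    ∫ ξ, pairIntegrand Φ ∅ ξ = Φ 0 := by
  have h : ∀ ξ : (∅ : Finset (Fin n × Fin n)) → ℝ, pairIntegrand Φ ∅ ξ = Φ 0 := by
    intro ξ
    have h0 : pairLift ξ = 0 := by
      ext i
      simp [pairLift]
    simp [pairIntegrand, h0]
  simp only [h]
  rw [integral_const, measureReal_def, volume_pi, Measure.pi_empty_univ]
  simp

-- The separate term Φ(0) is the contribution of the empty pairing, and no pairing has more than n/2
-- pairs.
open Classical in
theorem mainTerm_eq_sum (Φ : SchwartzMap (Fin n → ℝ) ℂ) :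
    mainTerm Φ = ∑ σ : Finset (Fin n × Fin n) with IsPairing σ, ∫ ξ, pairIntegrand Φ σ ξ := by
  have h1 : ∀ m, disjointPairs n m = (Finset.univ.filter fun σ => IsPairing σ).filter
      fun σ => σ.card = m := by
    intro m
    ext σ
    rw [disjointPairs, Finset.mem_filter, Finset.mem_filter, Finset.mem_filter]
    simp only [Finset.mem_univ, true_and]
    exact and_comm
  have h2 : (Finset.univ.filter fun σ : Finset (Fin n × Fin n) => IsPairing σ).filter
      (fun σ => σ.card = 0) = {∅} := by
    ext σ
    simp only [Finset.mem_filter, Finset.mem_univ, true_and, Finset.card_eq_zero,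
      Finset.mem_singleton, and_iff_right_iff_imp]
    rintro rfl
    constructor <;> simp
  unfold mainTerm
  simp only [← integral_pairIntegrand_eq, h1]
  rw [← Finset.sum_fiberwise_of_maps_to (s := Finset.univ.filter fun σ => IsPairing σ)
    (t := Finset.range (n / 2 + 1)) (g := Finset.card) fun σ hσ => ?_]
  · rw [Finset.range_eq_Ico, Finset.sum_eq_sum_Ico_succ_bot (by omega), h2, Finset.sum_singleton,
      integral_pairIntegrand_empty]
    rfl
  · have := ((Finset.mem_filter.mp hσ).2).two_mul_card_le
    rw [Finset.mem_range]
    omega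

/-- The main term evaluates Φ only at vectors of zero sum, where φ determines it. -/
theorem mainTerm_congr {d : ℕ} {φ : (Fin (d + 1) → ℝ) → ℂ}
    {Φ Φ' : SchwartzMap (Fin (d + 1) → ℝ) ℂ} (h : IsRestrictedTransform φ Φ)
    (h' : IsRestrictedTransform φ Φ') : mainTerm Φ = mainTerm Φ' := by
  rw [mainTerm_eq_sum, mainTerm_eq_sum]
  refine Finset.sum_congr rfl fun σ _ => integral_congr_ae (Filter.Eventually.of_forall fun ξ => ?_)
  simp only [pairIntegrand]
  rw [apply_eq_of_sum_eq_zero h h' (sum_pairLift ξ)]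

theorem exists_integral_correlation_sub_mainTerm_le {d : ℕ} {φ : (Fin (d + 1) → ℝ) → ℂ}
    {Φ : SchwartzMap (Fin (d + 1) → ℝ) ℂ} (h : IsRestrictedTransform φ Φ) :
    ∃ C : ℝ, ∀ N : ℕ, 1 ≤ N →
      ‖(∫ U : Matrix.unitaryGroup (Fin N) ℂ, correlation U φ ∂(haarUnitary N)) - mainTerm Φ‖ ≤
        C / N := by
  classical
  have hC : ∀ σ : Finset (Fin (d + 1) × Fin (d + 1)), ∃ C, IsPairing σ → ∀ N : ℕ, 1 ≤ N →
      ‖((N : ℂ) ^ σ.card)⁻¹ * (∑' u : σ → ℤ, pairIntegrand Φ σ fun p => (u p : ℝ) / N) -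
        ∫ ξ, pairIntegrand Φ σ ξ‖ ≤ C / N := by
    intro σ
    by_cases hσ : IsPairing σ
    · obtain ⟨C, hC⟩ := exists_riemann_pairIntegrand h.support hσ
      exact ⟨C, fun _ => hC⟩
    · exact ⟨0, fun h => absurd h hσ⟩
  choose C hC using hC
  refine ⟨∑ σ : Finset (Fin (d + 1) × Fin (d + 1)) with IsPairing σ, C σ, fun N hN => ?_⟩
  rw [integral_correlation h hN, mainTerm_eq_sum, ← Finset.sum_sub_distrib, Finset.sum_div]
  exact norm_sum_le_of_le _ fun σ hσ => hC σ (Finset.mem_filter.mp hσ).2 N hN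

end MainTerm

end UnitaryCorrelation

end

/-! ### The asymptotic formula, with a constant depending only on n and φ -/

theorem theorem1 (d : ℕ) (φ : (Fin (d + 1) → ℝ) → ℂ)
    (hφ : UnitaryCorrelation.IsTestFunction φ) :
    ∃ C : ℝ, ∀ Φ : SchwartzMap (Fin (d + 1) → ℝ) ℂ,
      UnitaryCorrelation.IsRestrictedTransform φ Φ →
      ∀ N : ℕ, 1 ≤ N →
        MeasureTheory.Integrable
          (fun U : Matrix.unitaryGroup (Fin N) ℂ => UnitaryCorrelation.correlation U φ)
          (UnitaryCorrelation.haarUnitary N) ∧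
        ‖(∫ U : Matrix.unitaryGroup (Fin N) ℂ, UnitaryCorrelation.correlation U φ
            ∂(UnitaryCorrelation.haarUnitary N)) - UnitaryCorrelation.mainTerm Φ‖ ≤ C / N := by
  -- The constant must precede Φ. One admissible Φ₀ supplies it for all, since the main terms
  -- coincide; if there is none, the claim is vacuous.
  by_cases hex : ∃ Φ₀, UnitaryCorrelation.IsRestrictedTransform φ Φ₀
  · obtain ⟨Φ₀, h₀⟩ := hex
    obtain ⟨C, hC⟩ := UnitaryCorrelation.exists_integral_correlation_sub_mainTerm_le h₀
    refine ⟨C, fun Φ h N hN => ⟨UnitaryCorrelation.integrable_correlation h hN, ?_⟩⟩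
    rw [UnitaryCorrelation.mainTerm_congr h h₀]
    exact hC N hN
  · exact ⟨0, fun Φ h => absurd ⟨Φ, h⟩ hex⟩
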